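/- Let $n\ge 0$ be an integer and let $Z$ be a nonempty complete bounded metric space of capacity dimension $n$, rescaled so that $\operatorname{diam} Z<1$. (Capacity dimension is the least $n$ for which there is $\delta\in(0,1)$ such that for every sufficiently small $\tau>0$ there is an open cover of $Z$, a union of $n+1$ disjoint subfamilies, whose members have diameter at most $\tau$ and such that each ball of radius $\delta\tau$ lies in a member.) **Cone.** For $0<r\le\frac16$, a hyperbolic cone $\mathrm{Cone}\,Z$ with parameter $r$ is the metric graph (with edges of length $1$) obtained by choosing, for each $k\ge0$, a maximal $r^k$-separated set $V_k\subset Z$. Its vertex set is $V=\bigsqcup_k V_k$, and $v\in V_k$ has level $k$ and ball $B(v)=B_Z(v,2r^k)$. Distinct vertices of the same level are joined when their closed balls (of radius $2r^k$) intersect, and $v\in V_k$, $w\in V_{k+1}$ are joined when $B(w)\subset B(v)$. **Covers.** Let $C$ be a set of $n+1$ colours. For $\varepsilon\in(0,1)$ and a cone with parameter $r$, consider sequences $(\mathcal U_k=\bigcup_{c\in C}\mathcal U_k^c)_{k\ge0}$ of open covers of $Z$ by nonempty sets, where each $\mathcal U^c_k$ is a family of pairwise disjoint sets, such that: 1. $\sup\{\operatorname{diam}U:U\in\mathcal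 U_k\}<r^k$ for all $k$, and $\mathcal U_0^c=\{Z\}$ for all $c$; 2. for every $v\in V_{k+1}$ there is $U\in\mathcal U_k$ with $B(v)\subset U$; 3. for every $c$, if $U\in\mathcal U^c_k$, $U'\in\mathcal U^c_{k'}$, $k\le k'$ and $(U,k)\ne(U',k')$, then the open $\varepsilon r^{k'}$-neighbourhood of $U'$ is either disjoint from $U$ or contained in $U$. **Trees.** Let $T_c$ be the graph whose vertices are the pairs $(U,k)$ with $U\in\mathcal U_k^c$, with root $(Z,0)$, where $(U,k)$ and $(U',k')$ with $k<k'$ are joined when $U'\subset U$ and there is no vertex $(U'',k'')$ with $U'\subset U''$ and $k<k''<k'$. **Map.** Define $f_c:\mathrm{Cone}\,Z\to T_c$ as follows. The vertex of level $0$ goes to the root. A vertex $v$ of level $k>0$ goes to the vertex $(U,j)$ with $B(v)\subset U$ whose level $j$ is maximal among those with $j<k$. A point in the interior of an edge $vw$ goes to $f_c(v)$ or to $f_c(w)$, chosen arbitrarily. Then: * there are $\varepsilon\in(0,1)$ and $r_0>0$ such that for every $r\in(0,\frac\varepsilon4)$ with $r<r_0$ there is a sequence of covers that satisfies 1–3 for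 every hyperbolic cone on $Z$ with parameter $r$; * for all $\varepsilon\in(0,1)$ and $0<r<\min\{\frac\varepsilon4,\frac17\}$, every hyperbolic cone on $Z$ with parameter $r$, every sequence of covers satisfying 1–3, and every resulting family of maps $f_c$, each $T_c$ is a tree and the map $f=(f_c)_{c\in C}:\mathrm{Cone}\,Z\to\prod_{c\in C}T_c$ to the product of $n+1$ rooted trees is quasimedian. That is, for every coarse median $\mu$ on $\mathrm{Cone}\,Z$ (in the sense of Bowditch) there is a constant $K$ such that, for all $x_1,x_2,x_3\in\mathrm{Cone}\,Z$, the point $f(\mu(x_1,x_2,x_3))$ is at distance at most $K$ from the componentwise tree median of $f(x_1),f(x_2),f(x_3)$. -/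

import Mathlib

open Set

noncomputable section

/-! ### Medians in graphs, coarse median spaces, quasimedian maps -/

/-- The vertex `m` lies on a geodesic of `G` between each two of the vertices `a`, `b`, `c`. -/
def IsGraphMedian {V : Type*} (G : SimpleGraph V) (a b c m : V) : Prop :=
  G.dist a m + G.dist m b = G.dist a b ∧
  G.dist b m + G.dist m c = G.dist b c ∧
  G.dist a m + G.dist m c = G.dist a c

/-- Median graphs. They are exactly the 1-skeleta of CAT(0) cube complexes. -/
def IsMedianGraph {V : Type*} (G : SimpleGraph V) : Prop :=
  G.Connected ∧ ∀ a b c : V, ∃! m : V, IsGraphMedian G a b c m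

open Classical in
/-- The median of three vertices of a median graph (for instance of a tree); the value is only
meaningful when a median exists. -/
def graphMedian {V : Type*} (G : SimpleGraph V) (a b c : V) : V :=
  if h : ∃ m : V, IsGraphMedian G a b c m then h.choose else a

/-- `μ` is a coarse median on the metric space `X` (Bowditch). The finite CAT(0) cube complex
that approximates a finite set is given by its 1-skeleton, a finite median graph. -/
def IsCoarseMedian {X : Type*} [PseudoMetricSpace X] (μ : X → X → X → X) : Prop :=
  ∃ h : ℕ → ℝ,
    (∀ x x' y y' z z' : X,
      dist (μ x y z) (μ x' y' z') ≤ h 1 * (1 + dist x x' + dist y y' + dist z z')) ∧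
    ∀ (n : ℕ) (A : Finset X), A.card ≤ n →
      ∃ (N : ℕ) (Q : SimpleGraph (Fin N)), IsMedianGraph Q ∧
        ∃ (p : A → Fin N) (q : Fin N → X),
          (∀ v₁ v₂ v₃ : Fin N,
            dist (q (graphMedian Q v₁ v₂ v₃)) (μ (q v₁) (q v₂) (q v₃)) ≤ h n) ∧
          ∀ a : A, dist (a : X) (q (p a)) ≤ h n

/-- Quasimedian maps, with respect to ternary operations on the source and the target. -/
def IsQuasimedian {X Y : Type*} [PseudoMetricSpace X] [PseudoMetricSpace Y]
    (μX : X → X → X → X) (μY : Y → Y → Y → Y) (φ : X → Y) : Prop :=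
  ∃ k : ℝ, ∀ x₁ x₂ x₃ : X, dist (φ (μX x₁ x₂ x₃)) (μY (φ x₁) (φ x₂) (φ x₃)) ≤ k

/-! ### Connected graphs as metric spaces -/

/-- The vertex set of a connected graph, with the path metric (all edges have length one). -/
def VertexSpace {V : Type*} (G : SimpleGraph V) (_hG : G.Connected) : Type _ := V

instance {V : Type*} (G : SimpleGraph V) (hG : G.Connected) : MetricSpace (VertexSpace G hG) where
  dist := fun (u v : V) => (G.dist u v : ℝ)
  dist_self := fun (u : V) => by rw [SimpleGraph.dist_self, Nat.cast_zero]
  dist_comm := fun (u v : V) => by rw [SimpleGraph.dist_comm]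
  dist_triangle u v w := by exact_mod_cast hG.dist_triangle
  eq_of_dist_eq_zero {u v} h := by
    have h' : G.dist u v = 0 := by exact_mod_cast h
    exact hG.dist_eq_zero_iff.mp h'

/-- Names for the points of the geometric realization of a graph: the point at distance `t` from
`src` on the edge from `src` to `tgt`, or the vertex `src` if `src = tgt` and `t = 0`.
A point inside an edge has two names, one for each orientation of the edge. -/
structure PrePoint {V : Type*} (G : SimpleGraph V) (hG : G.Connected) where
  src : V
  tgt : V
  t : ℝ
  t_nonneg : 0 ≤ t
  t_le : t ≤ 1
  adj : G.Adj src tgt ∨ (src = tgt ∧ t = 0)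

namespace PrePoint

variable {V : Type*} {G : SimpleGraph V} {hG : G.Connected}

/-- The two endpoints of the edge on which a point lies. -/
def endpt (p : PrePoint G hG) (b : Bool) : V := if b then p.tgt else p.src

/-- The distance, along the edge, from a point to an endpoint of its edge. -/
def offset (p : PrePoint G hG) (b : Bool) : ℝ := if b then 1 - p.t else p.t

/-- `Joins p q ℓ`: there is a path of length `ℓ` from `p` to `q` that either leaves the edge of `p`
and arrives at `q` through endpoints of their edges, following a geodesic of `G` in between, or
runs inside a common edge (with equal or with opposite orientations). -/
inductive Joins (p q : PrePoint G hG) : ℝ → Prop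
  | through (b b' : Bool) :
      Joins p q (p.offset b + (G.dist (p.endpt b) (q.endpt b') : ℝ) + q.offset b')
  | same (hs : p.src = q.src) (ht : p.tgt = q.tgt) : Joins p q |p.t - q.t|
  | opposite (hs : p.src = q.tgt) (ht : p.tgt = q.src) : Joins p q |p.t - (1 - q.t)|

lemma offset_nonneg (p : PrePoint G hG) (b : Bool) : 0 ≤ p.offset b := by
  have := p.t_nonneg; have := p.t_le
  cases b <;> simp [offset] <;> linarith

lemma Joins.nonneg {p q : PrePoint G hG} {l : ℝ} (h : Joins p q l) : 0 ≤ l := by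
  cases h with
  | through b b' =>
    have := p.offset_nonneg b; have := q.offset_nonneg b'; positivity
  | same => exact abs_nonneg _
  | opposite => exact abs_nonneg _

lemma Joins.symm {p q : PrePoint G hG} {l : ℝ} (h : Joins p q l) : Joins q p l := by
  cases h with
  | through b b' =>
    have := Joins.through (p := q) (q := p) b' b
    rw [SimpleGraph.dist_comm] at this
    have e : p.offset b + (G.dist (p.endpt b) (q.endpt b') : ℝ) + q.offset b' =
        q.offset b' + (G.dist (p.endpt b) (q.endpt b') : ℝ) + p.offset b := by ring
    rw [e]; exact this
  | same hs ht => rw [abs_sub_comm]; exact .same hs.symm ht.symm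
  | opposite hs ht =>
    have := Joins.opposite (p := q) (q := p) ht.symm hs.symm
    have e : p.t - (1 - q.t) = q.t - (1 - p.t) := by ring
    rw [e]; exact this

lemma dist_endpt_le (m : PrePoint G hG) (b b' : Bool) :
    (G.dist (m.endpt b) (m.endpt b') : ℝ) ≤ m.offset b + m.offset b' := by
  have h1 := m.t_nonneg
  have h2 := m.t_le
  have h3 : (G.dist m.src m.tgt : ℝ) ≤ 1 := by
    rcases m.adj with h | ⟨h, -⟩
    · rw [SimpleGraph.dist_eq_one_iff_adj.mpr h]; simp
    · rw [h]; simp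
  have h4 : (G.dist m.tgt m.src : ℝ) ≤ 1 := by rw [SimpleGraph.dist_comm]; exact h3
  cases b <;> cases b' <;>
    simp only [endpt, offset, if_true, if_false, Bool.false_eq_true, SimpleGraph.dist_self,
      Nat.cast_zero] <;> linarith

lemma Joins.trans {p m q : PrePoint G hG} {l l' : ℝ} (h : Joins p m l) (h' : Joins m q l') :
    ∃ l'', Joins p q l'' ∧ l'' ≤ l + l' := by
  cases h with
  | through b b₁ =>
    cases h' with
    | through b₂ b' =>
      refine ⟨_, .through b b', ?_⟩
      have h1 := m.dist_endpt_le b₁ b₂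
      have h2 : (G.dist (p.endpt b) (q.endpt b') : ℝ) ≤ G.dist (p.endpt b) (m.endpt b₁) +
          G.dist (m.endpt b₁) (m.endpt b₂) + G.dist (m.endpt b₂) (q.endpt b') := by
        have e1 := hG.dist_triangle (u := p.endpt b) (v := m.endpt b₁) (w := q.endpt b')
        have e2 := hG.dist_triangle (u := m.endpt b₁) (v := m.endpt b₂) (w := q.endpt b')
        exact_mod_cast (by omega : G.dist (p.endpt b) (q.endpt b') ≤ G.dist (p.endpt b)
          (m.endpt b₁) + G.dist (m.endpt b₁) (m.endpt b₂) + G.dist (m.endpt b₂) (q.endpt b'))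
      linarith
    | same hs ht =>
      refine ⟨_, .through b b₁, ?_⟩
      have e : q.endpt b₁ = m.endpt b₁ := by cases b₁ <;> simp [endpt, hs, ht]
      rw [e]
      have := le_abs_self (m.t - q.t); have := neg_abs_le (m.t - q.t)
      cases b₁ <;> simp [offset] <;> linarith
    | opposite hs ht =>
      refine ⟨_, .through b (!b₁), ?_⟩
      have e : q.endpt (!b₁) = m.endpt b₁ := by cases b₁ <;> simp [endpt, hs, ht]
      rw [e]
      have := le_abs_self (m.t - (1 - q.t)); have := neg_abs_le (m.t - (1 - q.t))
      cases b₁ <;> simp [offset] <;> linarith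
  | same hs ht =>
    cases h' with
    | through b₂ b' =>
      refine ⟨_, .through b₂ b', ?_⟩
      have e : p.endpt b₂ = m.endpt b₂ := by cases b₂ <;> simp [endpt, hs, ht]
      rw [e]
      have := le_abs_self (p.t - m.t); have := neg_abs_le (p.t - m.t)
      cases b₂ <;> simp [offset] <;> linarith
    | same hs' ht' => exact ⟨_, .same (hs.trans hs') (ht.trans ht'), abs_sub_le _ _ _⟩
    | opposite hs' ht' => exact ⟨_, .opposite (hs.trans hs') (ht.trans ht'), abs_sub_le _ _ _⟩
  | opposite hs ht =>
    cases h' with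
    | through b₂ b' =>
      refine ⟨_, .through (!b₂) b', ?_⟩
      have e : p.endpt (!b₂) = m.endpt b₂ := by cases b₂ <;> simp [endpt, hs, ht]
      rw [e]
      have := le_abs_self (p.t - (1 - m.t)); have := neg_abs_le (p.t - (1 - m.t))
      cases b₂ <;> simp [offset] <;> linarith
    | same hs' ht' =>
      refine ⟨_, .opposite (hs.trans ht') (ht.trans hs'), ?_⟩
      have := abs_sub_le p.t (1 - m.t) (1 - q.t)
      have e : |1 - m.t - (1 - q.t)| = |m.t - q.t| := by rw [← abs_neg]; congr 1; ring
      linarith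
    | opposite hs' ht' =>
      refine ⟨_, .same (hs.trans ht') (ht.trans hs'), ?_⟩
      have := abs_sub_le p.t (1 - m.t) q.t
      have e : |1 - m.t - q.t| = |m.t - (1 - q.t)| := by rw [← abs_neg]; congr 1; ring
      linarith

/-- The path (pseudo-)metric, in which every edge is an interval of length one. -/
instance : PseudoMetricSpace (PrePoint G hG) where
  dist p q := sInf {l | Joins p q l}
  dist_self p := le_antisymm
    (csInf_le ⟨0, fun _ h => h.nonneg⟩ (by
      have := Joins.same (p := p) (q := p) rfl rfl
      simpa using this))
    (Real.sInf_nonneg fun _ h => Joins.nonneg h)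
  dist_comm p q := by
    congr 1; ext l; exact ⟨Joins.symm, Joins.symm⟩
  dist_triangle p m q := by
    have key : ∀ l, Joins p m l → ∀ l', Joins m q l' → sInf {l | Joins p q l} ≤ l + l' := by
      intro l h l' h'
      obtain ⟨l'', h1, h2⟩ := h.trans h'
      exact (csInf_le ⟨0, fun _ h => h.nonneg⟩ h1).trans h2
    have n1 : {l | Joins p m l}.Nonempty := ⟨_, .through false false⟩
    have n2 : {l | Joins m q l}.Nonempty := ⟨_, .through false false⟩
    have s1 : ∀ l', Joins m q l' →
        sInf {l | Joins p q l} - l' ≤ sInf {l | Joins p m l} := fun l' h' =>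
      le_csInf n1 fun l h => by have := key l h l' h'; linarith
    have s2 : sInf {l | Joins p q l} - sInf {l | Joins p m l} ≤ sInf {l | Joins m q l} :=
      le_csInf n2 fun l' h' => by have := s1 l' h'; linarith
    linarith

end PrePoint

/-- The geometric realization of a connected graph, a metric space: names of points at
distance zero are identified. -/
abbrev Realization {V : Type*} (G : SimpleGraph V) (hG : G.Connected) : Type _ :=
  SeparationQuotient (PrePoint G hG)

namespace Realization

variable {V : Type*} (G : SimpleGraph V) (hG : G.Connected)

/-- A vertex, as a point of the realization. -/
def vertex (v : V) : Realization G hG :=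
  SeparationQuotient.mk ⟨v, v, 0, le_rfl, zero_le_one, Or.inr ⟨rfl, rfl⟩⟩

/-- The point at distance `t` from `u` on the edge `uv`. -/
def edgePoint {u v : V} (h : G.Adj u v) (t : ℝ) (ht : t ∈ Icc (0 : ℝ) 1) : Realization G hG :=
  SeparationQuotient.mk ⟨u, v, t, ht.1, ht.2, Or.inl h⟩

end Realization

/-! ### Capacity dimension -/

/-- `Z` has capacity dimension at most `n`: for some `δ` and for every sufficiently small `τ`, there
is an `(n+1)`-coloured open cover with mesh at most `τ` and Lebesgue number at least `δ τ`. -/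
def CapacityDimLE (Z : Type*) [PseudoMetricSpace Z] (n : ℕ) : Prop :=
  ∃ δ ∈ Ioo (0 : ℝ) 1, ∃ τ₀ > 0, ∀ τ ∈ Ioo (0 : ℝ) τ₀,
    ∃ W : Fin (n + 1) → Set (Set Z),
      (∀ c, ∀ U ∈ W c, IsOpen U) ∧
      (∀ c, (W c).PairwiseDisjoint id) ∧
      (∀ c, ∀ U ∈ W c, ∀ x ∈ U, ∀ y ∈ U, dist x y ≤ τ) ∧
      ∀ z : Z, ∃ c, ∃ U ∈ W c, Metric.ball z (δ * τ) ⊆ U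

/-- The capacity dimension: the least `n` with `CapacityDimLE Z n`, or `⊤` if there is none. -/
def capacityDim (Z : Type*) [PseudoMetricSpace Z] : ℕ∞ :=
  ⨅ (n : ℕ) (_ : CapacityDimLE Z n), (n : ℕ∞)

/-! ### The hyperbolic cone -/

/-- `S` is `a`-separated. -/
def IsSepSet {Z : Type*} [PseudoMetricSpace Z] (a : ℝ) (S : Set Z) : Prop :=
  ∀ x ∈ S, ∀ y ∈ S, x ≠ y → a ≤ dist x y

/-- The choices that determine a hyperbolic cone on `Z` with parameter `r`: for every `k` a maximal
`r ^ k`-separated subset of `Z`. -/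
structure HyperbolicCone (Z : Type*) [PseudoMetricSpace Z] (r : ℝ) where
  pos : 0 < r
  le : r ≤ 1 / 6
  net : ℕ → Set Z
  maximal : ∀ k, Maximal (IsSepSet (r ^ k)) (net k)

namespace HyperbolicCone

variable {Z : Type*} [PseudoMetricSpace Z] {r : ℝ} (H : HyperbolicCone Z r)

/-- The disjoint union of the nets; the first component of a vertex is its level. -/
abbrev Vertex : Type _ := (k : ℕ) × H.net k

variable {H} in
/-- The open ball `B(v)` of radius `2 r ^ k` associated with a vertex `v` of level `k`. -/
def Vertex.ball (v : H.Vertex) : Set Z := Metric.ball (v.2 : Z) (2 * r ^ v.1)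

variable {H} in
/-- The closed ball of radius `2 r ^ k` associated with a vertex of level `k`. -/
def Vertex.closedBall (v : H.Vertex) : Set Z := Metric.closedBall (v.2 : Z) (2 * r ^ v.1)

/-- The graph of the cone: distinct vertices of equal level are adjacent if their closed balls
meet, vertices of consecutive levels are adjacent if their open balls are nested. -/
def graph : SimpleGraph H.Vertex :=
  SimpleGraph.fromRel fun v w =>
    (v.1 = w.1 ∧ (v.closedBall ∩ w.closedBall).Nonempty) ∨
    (v.1 + 1 = w.1 ∧ w.ball ⊆ v.ball)

lemma exists_near (k : ℕ) (z : Z) : ∃ v ∈ H.net k, dist z v < r ^ k := by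
  by_contra! hcon
  have hk : 0 < r ^ k := pow_pos H.pos k
  have hsep : IsSepSet (r ^ k) (insert z (H.net k)) := by
    rintro x (rfl | hx) y (rfl | hy) hxy
    · exact absurd rfl hxy
    · exact hcon y hy
    · rw [dist_comm]; exact hcon x hx
    · exact (H.maximal k).prop x hx y hy hxy
  have hz : z ∈ H.net k := (H.maximal k).le_of_ge hsep (subset_insert _ _) (mem_insert _ _)
  have := hcon z hz
  rw [dist_self] at this
  linarith

theorem graph_connected [BoundedSpace Z] [Nonempty Z]
    (hZ : Metric.diam (univ : Set Z) < 1) : H.graph.Connected := by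
  obtain ⟨z₀⟩ := ‹Nonempty Z›
  obtain ⟨o, ho, -⟩ := H.exists_near 0 z₀
  have key : ∀ (k : ℕ) (v : Z) (hv : v ∈ H.net k),
      H.graph.Reachable ⟨0, ⟨o, ho⟩⟩ ⟨k, ⟨v, hv⟩⟩ := by
    intro k
    induction k with
    | zero =>
      intro v hv
      have : v = o := by
        by_contra hne
        have h1 := (H.maximal 0).prop v hv o ho hne
        have h2 := Metric.dist_le_diam_of_mem (Bornology.IsBounded.all (univ : Set Z))
          (mem_univ v) (mem_univ o)
        rw [pow_zero] at h1
        linarith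
      subst this
      exact SimpleGraph.Reachable.refl _
    | succ k ih =>
      intro v hv
      obtain ⟨w, hw, hvw⟩ := H.exists_near k v
      refine (ih w hw).trans (SimpleGraph.Adj.reachable ?_)
      rw [graph, SimpleGraph.fromRel_adj]
      refine ⟨fun h => by simpa using congrArg Sigma.fst h, Or.inl (Or.inr ⟨rfl, ?_⟩)⟩
      intro x hx
      simp only [Vertex.ball, Metric.mem_ball] at hx ⊢
      have h1 := dist_triangle x v w
      have hk : 0 < r ^ k := pow_pos H.pos k
      have h2 : r ^ (k + 1) ≤ r ^ k * (1 / 6) := by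
        rw [pow_succ]; exact mul_le_mul_of_nonneg_left H.le hk.le
      linarith
  have : Nonempty H.Vertex := ⟨⟨0, ⟨o, ho⟩⟩⟩
  refine SimpleGraph.Connected.mk ?_
  rintro ⟨k, v, hv⟩ ⟨l, w, hw⟩
  exact (key k v hv).symm.trans (key l w hw)

/-- The hyperbolic cone on a nonempty bounded space of diameter less than one, as a metric space:
the realization of its graph. -/
abbrev Space [BoundedSpace Z] [Nonempty Z] (hZ : Metric.diam (univ : Set Z) < 1) : Type _ :=
  Realization H.graph (H.graph_connected hZ)

end HyperbolicCone

/-! ### Coloured covers and their trees -/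

/-- A sequence of open covers of `Z`, coloured by `C`, with nonempty members, in which members
of the same colour (and possibly of different levels) are nested or well separated. -/
structure ColouredCovers (Z : Type*) [PseudoMetricSpace Z] (C : Type*) (r ε : ℝ) where
  sets : ℕ → C → Set (Set Z)
  isOpen : ∀ k c, ∀ U ∈ sets k c, IsOpen U
  nonempty : ∀ k c, ∀ U ∈ sets k c, U.Nonempty
  covers : ∀ k (z : Z), ∃ c, ∃ U ∈ sets k c, z ∈ U
  disjoint : ∀ k c, (sets k c).PairwiseDisjoint id
  mesh : ∀ k, ∃ ρ < r ^ k, ∀ c, ∀ U ∈ sets k c, ∀ x ∈ U, ∀ y ∈ U, dist x y ≤ ρ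
  level_zero : ∀ c, sets 0 c = {univ}
  nested : ∀ c k k' U U', U ∈ sets k c → U' ∈ sets k' c → k ≤ k' → (k, U) ≠ (k', U') →
    Disjoint (Metric.thickening (ε * r ^ k') U') U ∨ Metric.thickening (ε * r ^ k') U' ⊆ U

namespace ColouredCovers

variable {Z : Type*} [PseudoMetricSpace Z] {C : Type*} {r ε : ℝ} (𝒰 : ColouredCovers Z C r ε)

/-- Every ball of the cone at level `k + 1` is contained in a member of the `k`-th cover. -/
def IsSubordinate (H : HyperbolicCone Z r) : Prop :=
  ∀ v : H.Vertex, ∀ k, v.1 = k + 1 → ∃ c, ∃ U ∈ 𝒰.sets k c, v.ball ⊆ U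

/-- The vertices of the tree of colour `c`: the members of colour `c` together with their level. -/
abbrev TreeVertex (c : C) : Type _ := (k : ℕ) × 𝒰.sets k c

/-- The root of the tree of colour `c`, which is `Z` itself at level zero. -/
def root (c : C) : 𝒰.TreeVertex c := ⟨0, ⟨univ, by rw [𝒰.level_zero]; rfl⟩⟩

/-- The tree of colour `c`: `(U, k)` and `(U', k')` with `k < k'` are joined by an edge if `U' ⊆ U`
and `U'` is contained in no member of colour `c` of a level strictly between `k` and `k'`. -/
def tree (c : C) : SimpleGraph (𝒰.TreeVertex c) :=
  SimpleGraph.fromRel fun p q =>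
    p.1 < q.1 ∧ (q.2 : Set Z) ⊆ p.2 ∧
      ¬ ∃ s : 𝒰.TreeVertex c, (q.2 : Set Z) ⊆ s.2 ∧ p.1 < s.1 ∧ s.1 < q.1

theorem tree_connected (c : C) : (𝒰.tree c).Connected := by
  classical
  have key : ∀ (k : ℕ) (U : Set Z) (hU : U ∈ 𝒰.sets k c),
      (𝒰.tree c).Reachable (𝒰.root c) ⟨k, ⟨U, hU⟩⟩ := by
    intro k
    induction k using Nat.strong_induction_on with
    | _ k ih =>
      intro U hU
      rcases Nat.eq_zero_or_pos k with rfl | hk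
      · have : U = univ := by
          have h := hU
          rw [𝒰.level_zero] at h
          exact h
        subst this
        exact SimpleGraph.Reachable.refl _
      · let P : ℕ → Prop := fun j => ∃ W ∈ 𝒰.sets j c, U ⊆ W
        have hP0 : P 0 := ⟨univ, by rw [𝒰.level_zero]; rfl, subset_univ _⟩
        obtain ⟨W, hW, hUW⟩ : P (Nat.findGreatest P (k - 1)) :=
          Nat.findGreatest_spec (Nat.zero_le _) hP0
        have hlt : Nat.findGreatest P (k - 1) < k := by
          have := Nat.findGreatest_le (P := P) (k - 1)
          omega
        refine (ih _ hlt W hW).trans (SimpleGraph.Adj.reachable ?_)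
        rw [tree, SimpleGraph.fromRel_adj]
        refine ⟨fun h => hlt.ne (congrArg Sigma.fst h), Or.inl ⟨hlt, hUW, ?_⟩⟩
        rintro ⟨⟨j, S, hS⟩, hUS, h1, h2⟩
        have h2' : j < k := h2
        have : j ≤ Nat.findGreatest P (k - 1) :=
          Nat.le_findGreatest (by omega) ⟨S, hS, hUS⟩
        exact absurd h1 (not_lt.mpr this)
  have : Nonempty (𝒰.TreeVertex c) := ⟨𝒰.root c⟩
  refine SimpleGraph.Connected.mk ?_
  rintro ⟨k, U, hU⟩ ⟨l, W, hW⟩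
  exact (key k U hU).symm.trans (key l W hW)

/-- The tree of colour `c`, as the metric space of its vertices. -/
abbrev TreeSpace (c : C) : Type _ := VertexSpace (𝒰.tree c) (𝒰.tree_connected c)

/-- The componentwise median on the product of the trees. -/
def productMedian (a b d : ∀ c, 𝒰.TreeSpace c) : ∀ c, 𝒰.TreeSpace c :=
  fun c => graphMedian (𝒰.tree c) (a c) (b c) (d c)

open Classical in
/-- The level of the image of a cone vertex `v` of level `k` in the tree of colour `c`: the greatest
level `j < k` (or `j = 0` if `k = 0`) of a member of colour `c` that contains the ball `B(v)`. -/
def imageLevel {H : HyperbolicCone Z r} (c : C) (v : H.Vertex) : ℕ :=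
  Nat.findGreatest (fun j => ∃ U ∈ 𝒰.sets j c, v.ball ⊆ U) (v.1 - 1)

lemma exists_image {H : HyperbolicCone Z r} (c : C) (v : H.Vertex) :
    ∃ U ∈ 𝒰.sets (𝒰.imageLevel c v) c, v.ball ⊆ U := by
  classical
  exact Nat.findGreatest_spec (P := fun j => ∃ U ∈ 𝒰.sets j c, v.ball ⊆ U) (Nat.zero_le _)
    ⟨univ, by rw [𝒰.level_zero]; rfl, subset_univ _⟩

/-- The map `f_c` on vertices of the cone: `v` goes to the (unique) member of colour `c` and
of level `imageLevel c v` that contains `B(v)`; the vertex of level zero goes to the root. -/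
def vertexMap {H : HyperbolicCone Z r} (c : C) (v : H.Vertex) : 𝒰.TreeSpace c :=
  (⟨𝒰.imageLevel c v, ⟨(𝒰.exists_image c v).choose, (𝒰.exists_image c v).choose_spec.1⟩⟩ :
    𝒰.TreeVertex c)

/-- `F` is a Buyalo-Dranishnikov-Schroeder map from the cone to the product of the trees: it is
given by `vertexMap` on vertices, and the `c`-component of the image of a point on an edge is the
`c`-component of the image of one of the ends of the edge, chosen arbitrarily. -/
def IsBDSMap {H : HyperbolicCone Z r} [BoundedSpace Z] [Nonempty Z]
    (hZ : Metric.diam (univ : Set Z) < 1) (F : H.Space hZ → ∀ c, 𝒰.TreeSpace c) : Prop :=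
  (∀ (v : H.Vertex) (c : C),
    F (Realization.vertex H.graph (H.graph_connected hZ) v) c = 𝒰.vertexMap c v) ∧
  ∀ (v w : H.Vertex) (h : H.graph.Adj v w) (t : ℝ) (ht : t ∈ Icc (0 : ℝ) 1) (c : C),
    F (Realization.edgePoint H.graph (H.graph_connected hZ) h t ht) c = 𝒰.vertexMap c v ∨
    F (Realization.edgePoint H.graph (H.graph_connected hZ) h t ht) c = 𝒰.vertexMap c w

end ColouredCovers

end

/-! Covers. At each scale r^k take a coloured cover with mesh and Lebesgue number comparable to r^k,
and shrink it so that members of one colour are separated by a multiple of r^k. To force nestedness,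
let each member absorb all chains of slightly fattened finer members that start in it. The gaps at a
level dominate everything that happens at finer levels, so chains from level l on have diameter at
most r^l (`Linked.dist_le`), and mesh and separation survive.

Trees. A vertex of T_c is encoded by its finite set of ancestors, which nestedness makes a chain.
The tree metric is the size of the symmetric difference of ancestor sets (`tree_dist_eq`) and the
tree median is the majority set. So a vertex is near the median of three others if few ancestors
separate it from each pair (`dist_graphMedian_le`).

Cone. For v, w of levels k, l put s(v,w) = d(v,w) + r^k + r^l. Up to constant factors, s² r^dist
equals r^(k+l). With a Ptolemy-type inequality for s this yields Gromov's four point condition. It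
also locates a vertex m near a geodesic from v to w: up to a factor, s(v,m) or s(w,m) is at most
r^level(m), and r^level(m) is at most s(v,w) (`exists_scale_le`). By the mesh bound and the
ε-nestedness, only boundedly many tree vertices then separate f_c(m) from both f_c(v) and f_c(w)
(`exists_gap_le`).

Coarse medians. In a hyperbolic graph μ(a,b,c) is near geodesics between each two of the points
(`CoarseMedianIdentities.exists_excess_le`): the map μ(a,b,·) is a coarse Lipschitz retraction, so a
Morse argument puts geodesics from a to b near its image, and identities of median algebras do the
rest. Hence the previous paragraph applies to the median and each pair of points. -/

/-! ### Coloured covers from capacity dimension -/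

/-- The points from which `y` is reached by a chain of sets of the families `X j`, `l ≤ j < m`,
in which consecutive sets meet. -/
def LinkedUpTo {Z : Type*} (X : ℕ → Set (Set Z)) (l m : ℕ) : Z → Z → Prop :=
  Relation.ReflTransGen fun x y => ∃ j, l ≤ j ∧ j < m ∧ ∃ A ∈ X j, x ∈ A ∧ y ∈ A

/-- Two points are linked from level `l` on if a chain of sets of the families `X j`, `l ≤ j`, in
which consecutive sets meet, leads from one to the other. -/
def Linked {Z : Type*} (X : ℕ → Set (Set Z)) (l : ℕ) : Z → Z → Prop :=
  Relation.ReflTransGen fun x y => ∃ j, l ≤ j ∧ ∃ A ∈ X j, x ∈ A ∧ y ∈ A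

lemma LinkedUpTo.mono {Z : Type*} {X : ℕ → Set (Set Z)} {l m l' m' : ℕ} (hl : l' ≤ l)
    (hm : m ≤ m') {x y : Z} (h : LinkedUpTo X l m x y) : LinkedUpTo X l' m' x y :=
  Relation.ReflTransGen.mono (fun _ _ ⟨j, h1, h2, h3⟩ => ⟨j, hl.trans h1, h2.trans_le hm, h3⟩) _ _ h

lemma Linked.exists_upTo {Z : Type*} {X : ℕ → Set (Set Z)} {l : ℕ} {x y : Z}
    (h : Linked X l x y) : ∃ m, LinkedUpTo X l m x y := by
  induction h with
  | refl => exact ⟨0, .refl⟩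
  | tail _ h2 ih =>
    obtain ⟨m, hm⟩ := ih
    obtain ⟨j, hj, hA⟩ := h2
    exact ⟨max m (j + 1), (hm.mono le_rfl (le_max_left _ _)).tail
      ⟨j, hj, lt_of_lt_of_le (Nat.lt_succ_self j) (le_max_right _ _), hA⟩⟩

/-- Between two visits to level `l` a chain uses only finer levels, so it moves by at most `r ^ (l +
1)`, too little to cross the gap between distinct sets of level `l`. Hence all its visits to level
`l` are to a single set. -/
lemma LinkedUpTo.cases_level {Z : Type*} [PseudoMetricSpace Z] {X : ℕ → Set (Set Z)} {r : ℝ}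
    {l m : ℕ} (hgap : ∀ A ∈ X l, ∀ B ∈ X l, ∀ x ∈ A, ∀ y ∈ B, dist x y ≤ r ^ (l + 1) → A = B)
    (hlt : ∀ x y, LinkedUpTo X (l + 1) m x y → dist x y ≤ r ^ (l + 1)) {x y : Z}
    (h : LinkedUpTo X l m x y) :
    LinkedUpTo X (l + 1) m x y ∨ ∃ A ∈ X l, ∃ p ∈ A, ∃ q ∈ A,
      LinkedUpTo X (l + 1) m x p ∧ LinkedUpTo X (l + 1) m q y := by
  induction h with
  | refl => exact .inl .refl
  | @tail y y' _ h2 ih =>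
    obtain ⟨j, hj, hjm, A, hA, hy, hy'⟩ := h2
    rcases hj.eq_or_lt with rfl | hj
    · rcases ih with ih | ⟨B, hB, p, hp, q, hq, h1, h3⟩
      · exact .inr ⟨A, hA, y, hy, y', hy', ih, .refl⟩
      · obtain rfl := hgap B hB A hA q hq y hy (hlt _ _ h3)
        exact .inr ⟨B, hB, p, hp, y', hy', h1, .refl⟩
    · rcases ih with ih | ⟨B, hB, p, hp, q, hq, h1, h3⟩
      · exact .inl (ih.tail ⟨j, hj, hjm, A, hA, hy, hy'⟩)
      · exact .inr ⟨B, hB, p, hp, q, hq, h1, h3.tail ⟨j, hj, hjm, A, hA, hy, hy'⟩⟩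

/-- Downward induction on `l`, with `d` bounding `m - l`: a chain is at worst two finer chains
around one set of level `l`, and `1/4 + 1/2 + 1/4 = 1`. -/
lemma LinkedUpTo.dist_le {Z : Type*} [PseudoMetricSpace Z] {X : ℕ → Set (Set Z)} {r : ℝ}
    (hr : 0 < r) (hr4 : r ≤ 1 / 4)
    (hdiam : ∀ j, 1 ≤ j → ∀ A ∈ X j, ∀ x ∈ A, ∀ y ∈ A, dist x y ≤ r ^ j / 2)
    (hgap : ∀ j, 1 ≤ j → ∀ A ∈ X j, ∀ B ∈ X j, ∀ x ∈ A, ∀ y ∈ B,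
      dist x y ≤ r ^ (j + 1) → A = B) (m : ℕ) :
    ∀ d l, 1 ≤ l → m ≤ l + d → ∀ x y, LinkedUpTo X l m x y → dist x y ≤ r ^ l := by
  intro d
  induction d with
  | zero =>
    intro l hl hm x y h
    have : x = y := by
      induction h with
      | refl => rfl
      | tail _ h2 _ => obtain ⟨j, h1, h3, -⟩ := h2; omega
    subst this
    rw [dist_self]; positivity
  | succ d ih =>
    intro l hl hm x y h
    have ih' := ih (l + 1) (by omega) (by omega)
    have hp : 0 < r ^ l := pow_pos hr l
    have hs : r ^ (l + 1) ≤ r ^ l * (1 / 4) := by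
      rw [pow_succ]; exact mul_le_mul_of_nonneg_left hr4 hp.le
    rcases h.cases_level (hgap l hl) ih' with h | ⟨A, hA, p, hp, q, hq, h1, h2⟩
    · have := ih' x y h; linarith
    · have e1 := ih' x p h1
      have e2 := hdiam l hl A hA p hp q hq
      have e3 := ih' q y h2
      have := dist_triangle4 x p q y
      linarith

lemma Linked.dist_le {Z : Type*} [PseudoMetricSpace Z] {X : ℕ → Set (Set Z)} {r : ℝ}
    (hr : 0 < r) (hr4 : r ≤ 1 / 4)
    (hdiam : ∀ j, 1 ≤ j → ∀ A ∈ X j, ∀ x ∈ A, ∀ y ∈ A, dist x y ≤ r ^ j / 2)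
    (hgap : ∀ j, 1 ≤ j → ∀ A ∈ X j, ∀ B ∈ X j, ∀ x ∈ A, ∀ y ∈ B,
      dist x y ≤ r ^ (j + 1) → A = B) {l : ℕ} (hl : 1 ≤ l) {x y : Z} (h : Linked X l x y) :
    dist x y ≤ r ^ l := by
  obtain ⟨m, hm⟩ := h.exists_upTo
  exact LinkedUpTo.dist_le hr hr4 hdiam hgap m m l hl (by omega) x y hm

/-- The set of the points that are linked to a point of `U`. -/
def saturation {Z : Type*} (X : ℕ → Set (Set Z)) (l : ℕ) (U : Set Z) : Set Z :=
  {y | ∃ x ∈ U, Linked X l x y}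

lemma subset_saturation {Z : Type*} (X : ℕ → Set (Set Z)) (l : ℕ) (U : Set Z) :
    U ⊆ saturation X l U := fun x hx => ⟨x, hx, .refl⟩

/-- The absorption property behind nestedness. -/
lemma subset_saturation_of_mem {Z : Type*} {X : ℕ → Set (Set Z)} {l j : ℕ} {U A : Set Z}
    (hj : l ≤ j) (hA : A ∈ X j) (h : (A ∩ saturation X l U).Nonempty) :
    A ⊆ saturation X l U := by
  obtain ⟨y, hy, x, hx, hxy⟩ := h
  exact fun z hz => ⟨x, hx, hxy.tail ⟨j, hj, A, hA, hy, hz⟩⟩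

lemma isOpen_saturation {Z : Type*} [TopologicalSpace Z] {X : ℕ → Set (Set Z)} {l : ℕ}
    {U : Set Z} (hX : ∀ j, l ≤ j → ∀ A ∈ X j, IsOpen A) (hU : IsOpen U) :
    IsOpen (saturation X l U) := by
  rw [isOpen_iff_forall_mem_open]
  rintro y ⟨x, hx, h⟩
  cases h with
  | refl => exact ⟨U, subset_saturation X l U, hU, hx⟩
  | @tail z _ h1 h2 =>
    obtain ⟨j, hj, A, hA, hz, hy⟩ := h2
    exact ⟨A, subset_saturation_of_mem hj hA ⟨z, hz, x, hx, h1⟩, hX j hj A hA, hy⟩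

/-- The families of a cover with Lebesgue number `2 s` can be shrunk so that distinct members
of the same colour have distance at least `s`, and the Lebesgue number is at least `s`. -/
lemma exists_separated_shrinking {Z C : Type*} [PseudoMetricSpace Z] {s τ : ℝ} (hs : 0 < s)
    (W : C → Set (Set Z)) (hdisj : ∀ c, (W c).PairwiseDisjoint id)
    (hdiam : ∀ c, ∀ U ∈ W c, ∀ x ∈ U, ∀ y ∈ U, dist x y ≤ τ)
    (hleb : ∀ z : Z, ∃ c, ∃ U ∈ W c, Metric.ball z (2 * s) ⊆ U) :
    ∃ W' : C → Set (Set Z), (∀ c, ∀ U ∈ W' c, IsOpen U) ∧ (∀ c, ∀ U ∈ W' c, U.Nonempty) ∧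
      (∀ c, ∀ U ∈ W' c, ∀ x ∈ U, ∀ y ∈ U, dist x y ≤ τ) ∧
      (∀ c, ∀ U ∈ W' c, ∀ V ∈ W' c, U ≠ V → ∀ x ∈ U, ∀ y ∈ V, s ≤ dist x y) ∧
      ∀ z : Z, ∃ c, ∃ U ∈ W' c, Metric.ball z s ⊆ U := by
  -- A point of `S U` has its whole `s`-ball inside `U`, so disjointness of `U` and `V` becomes
  -- separation of `S U` and `S V`. As a union of balls `S U` is open, whether or not `U` is.
  let S : Set Z → Set Z := fun U => ⋃ z ∈ {z | Metric.ball z (2 * s) ⊆ U}, Metric.ball z s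
  have hS : ∀ U, ∀ x ∈ S U, Metric.ball x s ⊆ U := by
    intro U x hx y hy
    simp only [S, mem_iUnion, mem_ofPred_eq, exists_prop, Metric.mem_ball] at hx
    obtain ⟨z, hz, hxz⟩ := hx
    apply hz
    rw [Metric.mem_ball] at hy ⊢
    have := dist_triangle y x z
    linarith
  have hsub : ∀ U, S U ⊆ U := fun U x hx => hS U x hx (Metric.mem_ball_self hs)
  refine ⟨fun c => {V | V.Nonempty ∧ ∃ U ∈ W c, V = S U}, ?_, ?_, ?_, ?_, ?_⟩
  · rintro c _ ⟨-, U, -, rfl⟩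
    exact isOpen_biUnion fun _ _ => Metric.isOpen_ball
  · exact fun c U hU => hU.1
  · rintro c _ ⟨-, U, hU, rfl⟩ x hx y hy
    exact hdiam c U hU x (hsub U hx) y (hsub U hy)
  · rintro c _ ⟨-, U, hU, rfl⟩ _ ⟨-, V, hV, rfl⟩ hne x hx y hy
    by_contra! hlt
    have hUV : U ≠ V := fun h => hne (by rw [h])
    refine Set.disjoint_left.mp (hdisj c hU hV hUV) (hS U x hx ?_) (hsub V hy)
    rwa [Metric.mem_ball, dist_comm]
  · intro z
    obtain ⟨c, U, hU, hz⟩ := hleb z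
    have hsubS : Metric.ball z s ⊆ S U := by
      intro y hy
      simp only [S, mem_iUnion, exists_prop]
      exact ⟨z, hz, hy⟩
    exact ⟨c, S U, ⟨⟨z, hsubS (Metric.mem_ball_self hs)⟩, U, hU, rfl⟩, hsubS⟩

/-- The infimum of a nonempty set of natural numbers is attained; that of the empty set would be
`⊤`. -/
lemma CapacityDimLE.of_capacityDim_eq {Z : Type*} [PseudoMetricSpace Z] {n : ℕ}
    (h : capacityDim Z = n) : CapacityDimLE Z n := by
  by_contra hcon
  have hex : ∃ m, CapacityDimLE Z m := by
    by_contra! hno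
    have : capacityDim Z = ⊤ := by simp [capacityDim, hno]
    rw [h] at this
    exact ENat.natCast_ne_top n this
  classical
  have hle : (Nat.find hex : ℕ∞) ≤ capacityDim Z :=
    le_iInf₂ fun m hm => by exact_mod_cast Nat.find_min' hex hm
  have hge : capacityDim Z ≤ (Nat.find hex : ℕ∞) := iInf₂_le _ (Nat.find_spec hex)
  have : n = Nat.find hex := by exact_mod_cast h.symm.trans (le_antisymm hge hle)
  exact hcon (this ▸ Nat.find_spec hex)

/-- Families at all scales `r ^ k`, `k ≥ 1`, saturated from the fine scales to the coarse ones,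
yield nested coloured covers. -/
theorem exists_colouredCovers {Z C : Type*} [PseudoMetricSpace Z] [BoundedSpace Z] [Nonempty C]
    (hZ : Metric.diam (univ : Set Z) < 1) [Nonempty Z] {r δ : ℝ} (hr : 0 < r) (hδ : δ < 1)
    (hrδ : r < δ / 64 / 4) (W : ℕ → C → Set (Set Z))
    (hopen : ∀ k, 1 ≤ k → ∀ c, ∀ U ∈ W k c, IsOpen U)
    (hne : ∀ k, 1 ≤ k → ∀ c, ∀ U ∈ W k c, U.Nonempty)
    (hdiam : ∀ k, 1 ≤ k → ∀ c, ∀ U ∈ W k c, ∀ x ∈ U, ∀ y ∈ U, dist x y ≤ r ^ k / 4)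
    (hsep : ∀ k, 1 ≤ k → ∀ c, ∀ U ∈ W k c, ∀ V ∈ W k c, U ≠ V → ∀ x ∈ U, ∀ y ∈ V,
      δ * r ^ k / 8 ≤ dist x y)
    (hleb : ∀ k, 1 ≤ k → ∀ z : Z, ∃ c, ∃ U ∈ W k c, Metric.ball z (δ * r ^ k / 8) ⊆ U) :
    ∃ 𝒰 : ColouredCovers Z C r (δ / 64), ∀ H : HyperbolicCone Z r, 𝒰.IsSubordinate H := by
  -- The fattening `δ / 32` is large enough to contain the `δ / 64 * r ^ j`-neighbourhood of the
  -- saturated member, because saturation adds at most `r ^ (j + 1) ≤ δ / 256 * r ^ j`. It is small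
  -- enough to leave gaps of `δ / 16 * r ^ j` out of the original `δ / 8 * r ^ j`.
  let X : C → ℕ → Set (Set Z) := fun c j =>
    {A | ∃ U ∈ W j c, A = Metric.thickening (δ / 32 * r ^ j) U}
  have hδ0 : 0 < δ := by linarith
  have hpow : ∀ k, 0 < r ^ k := fun k => pow_pos hr k
  have hsucc : ∀ k, r ^ (k + 1) ≤ δ / 256 * r ^ k := fun k => by
    rw [pow_succ, mul_comm]; exact mul_le_mul_of_nonneg_right (by linarith) (hpow k).le
  have hδr : ∀ k, δ * r ^ k ≤ r ^ k := fun k => by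
    have := mul_le_mul_of_nonneg_right hδ.le (hpow k).le; linarith
  have hδr0 : ∀ k, 0 < δ * r ^ k := fun k => mul_pos hδ0 (hpow k)
  have hXdiam : ∀ c j, 1 ≤ j → ∀ A ∈ X c j, ∀ x ∈ A, ∀ y ∈ A, dist x y ≤ r ^ j / 2 := by
    rintro c j hj _ ⟨U, hU, rfl⟩ x hx y hy
    obtain ⟨x', hx', h1⟩ := Metric.mem_thickening_iff.mp hx
    obtain ⟨y', hy', h2⟩ := Metric.mem_thickening_iff.mp hy
    have h3 := hdiam j hj c U hU x' hx' y' hy'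
    have h4 := dist_triangle4 x x' y' y
    rw [dist_comm y' y] at h4
    have := hδr j; have := hpow j
    linarith
  have hXgap : ∀ c j, 1 ≤ j → ∀ A ∈ X c j, ∀ B ∈ X c j, ∀ x ∈ A, ∀ y ∈ B,
      dist x y ≤ r ^ (j + 1) → A = B := by
    rintro c j hj _ ⟨U, hU, rfl⟩ _ ⟨V, hV, rfl⟩ x hx y hy hxy
    obtain ⟨x', hx', h1⟩ := Metric.mem_thickening_iff.mp hx
    obtain ⟨y', hy', h2⟩ := Metric.mem_thickening_iff.mp hy
    by_cases hUV : U = V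
    · rw [hUV]
    have h3 := hsep j hj c U hU V hV hUV x' hx' y' hy'
    have h4 := dist_triangle4 x' x y y'
    rw [dist_comm x' x] at h4
    have := hsucc j; have := hδr0 j
    linarith
  have hlink : ∀ c l, 1 ≤ l → ∀ x y, Linked (X c) l x y → dist x y ≤ r ^ l :=
    fun c l hl x y h => h.dist_le hr (by linarith) (hXdiam c) (hXgap c) hl
  have hXopen : ∀ c j, ∀ A ∈ X c j, IsOpen A := by
    rintro c j _ ⟨U, -, rfl⟩
    exact Metric.isOpen_thickening
  let sets : ℕ → C → Set (Set Z) := fun k c =>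
    if k = 0 then {univ} else {V | ∃ U ∈ W k c, V = saturation (X c) (k + 1) U}
  have hsets0 : ∀ c, sets 0 c = {univ} := fun c => if_pos rfl
  have hsets : ∀ k, 1 ≤ k → ∀ c, sets k c = {V | ∃ U ∈ W k c, V = saturation (X c) (k + 1) U} :=
    fun k hk c => if_neg (by omega)
  have hmem0 : ∀ c, univ ∈ sets 0 c := fun c => by rw [hsets0]; rfl
  have hcov : ∀ k, 1 ≤ k → ∀ z : Z, ∃ c, ∃ U ∈ sets k c,
      Metric.ball z (δ * r ^ k / 8) ⊆ U := by
    intro k hk z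
    obtain ⟨c, U, hU, hz⟩ := hleb k hk z
    refine ⟨c, saturation (X c) (k + 1) U, ?_, hz.trans (subset_saturation _ _ _)⟩
    rw [hsets k hk]
    exact ⟨U, hU, rfl⟩
  have hfar : ∀ k, 1 ≤ k → ∀ c, ∀ U ∈ W k c, ∀ V ∈ W k c, U ≠ V →
      ∀ x ∈ saturation (X c) (k + 1) U, ∀ y ∈ saturation (X c) (k + 1) V,
      δ / 64 * r ^ k ≤ dist x y := by
    rintro k hk c U hU V hV hUV x ⟨x', hx', h1⟩ y ⟨y', hy', h2⟩
    have h3 := hsep k hk c U hU V hV hUV x' hx' y' hy'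
    have h4 := dist_triangle4 x' x y y'
    have h5 := hlink c _ (by omega) _ _ h1
    have h6 := hlink c _ (by omega) _ _ h2
    rw [dist_comm y'] at h6
    have := hsucc k; have := hδr0 k
    linarith
  refine ⟨{
    sets := sets
    isOpen := ?_
    nonempty := ?_
    covers := ?_
    disjoint := ?_
    mesh := ?_
    level_zero := hsets0
    nested := ?_ }, ?_⟩
  · intro k c U hU
    rcases Nat.eq_zero_or_pos k with rfl | hk
    · rw [hsets0] at hU
      rw [mem_singleton_iff.mp hU]
      exact isOpen_univ
    · rw [hsets k hk] at hU
      obtain ⟨U, hU, rfl⟩ := hU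
      exact isOpen_saturation (fun j _ => hXopen c j) (hopen k hk c U hU)
  · intro k c U hU
    rcases Nat.eq_zero_or_pos k with rfl | hk
    · rw [hsets0] at hU
      rw [mem_singleton_iff.mp hU]
      exact univ_nonempty
    · rw [hsets k hk] at hU
      obtain ⟨U, hU, rfl⟩ := hU
      exact (hne k hk c U hU).mono (subset_saturation _ _ _)
  · intro k z
    rcases Nat.eq_zero_or_pos k with rfl | hk
    · exact ⟨Classical.arbitrary C, univ, hmem0 _, mem_univ z⟩
    · obtain ⟨c, U, hU, hz⟩ := hcov k hk z
      exact ⟨c, U, hU, hz (Metric.mem_ball_self (by have := hδr0 k; linarith))⟩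
  · intro k c U hU V hV hUV
    rcases Nat.eq_zero_or_pos k with rfl | hk
    · rw [hsets0] at hU hV
      exact absurd (hU.trans hV.symm) hUV
    · rw [hsets k hk] at hU hV
      obtain ⟨U, hU, rfl⟩ := hU
      obtain ⟨V, hV, rfl⟩ := hV
      refine Set.disjoint_left.mpr fun x hx hy => ?_
      have := hfar k hk c U hU V hV (fun h => hUV (by rw [h])) x hx x hy
      rw [dist_self] at this
      have := hδr0 k
      linarith
  · intro k
    rcases Nat.eq_zero_or_pos k with rfl | hk
    · refine ⟨Metric.diam (univ : Set Z), by simpa using hZ, fun c U _ x _ y _ => ?_⟩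
      exact Metric.dist_le_diam_of_mem (Bornology.IsBounded.all _) (mem_univ x) (mem_univ y)
    · refine ⟨r ^ k / 2, by have := hpow k; linarith, fun c U hU x hx y hy => ?_⟩
      rw [hsets k hk] at hU
      obtain ⟨U, hU, rfl⟩ := hU
      obtain ⟨x', hx', h1⟩ := hx
      obtain ⟨y', hy', h2⟩ := hy
      have h3 := hdiam k hk c U hU x' hx' y' hy'
      have h4 := dist_triangle4 x x' y' y
      rw [dist_comm x x'] at h4
      have h5 := hlink c _ (by omega) _ _ h1
      have h6 := hlink c _ (by omega) _ _ h2
      have := hsucc k; have := hδr k; have := hpow k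
      linarith
  · intro c k k' U U' hU hU' hkk hne'
    rcases Nat.eq_zero_or_pos k with rfl | hk
    · rw [hsets0] at hU
      rw [mem_singleton_iff.mp hU]
      exact .inr (subset_univ _)
    rw [hsets k hk] at hU
    rw [hsets k' (hk.trans_le hkk)] at hU'
    obtain ⟨U, hU, rfl⟩ := hU
    obtain ⟨U', hU', rfl⟩ := hU'
    rcases hkk.eq_or_lt with rfl | hlt
    · refine .inl (Set.disjoint_left.mpr fun x hx hy => ?_)
      obtain ⟨z, hz, hxz⟩ := Metric.mem_thickening_iff.mp hx
      have := hfar k hk c U hU U' hU' (fun h => hne' (by rw [h])) x hy z hz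
      linarith
    -- The neighbourhood of the finer member lies in one set of `X c k'` with `k' ≥ k + 1`; that set
    -- is absorbed by the coarser member as soon as it meets it.
    · have hsub : Metric.thickening (δ / 64 * r ^ k') (saturation (X c) (k' + 1) U') ⊆
          Metric.thickening (δ / 32 * r ^ k') U' := by
        intro x hx
        obtain ⟨y, ⟨z, hz, hzy⟩, hxy⟩ := Metric.mem_thickening_iff.mp hx
        refine Metric.mem_thickening_iff.mpr ⟨z, hz, ?_⟩
        have h1 := hlink c _ (by omega) _ _ hzy
        rw [dist_comm] at h1
        have h2 := dist_triangle x y z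
        have := hsucc k'; have := hδr0 k'
        linarith
      by_cases hdis : (Metric.thickening (δ / 32 * r ^ k') U' ∩
          saturation (X c) (k + 1) U).Nonempty
      · exact .inr (hsub.trans (subset_saturation_of_mem hlt ⟨U', hU', rfl⟩ hdis))
      · exact .inl ((Set.disjoint_iff_inter_eq_empty.mpr
          (Set.not_nonempty_iff_eq_empty.mp hdis)).mono_left hsub)
  · intro H v k hv
    rcases Nat.eq_zero_or_pos k with rfl | hk
    · exact ⟨Classical.arbitrary C, univ, hmem0 (Classical.arbitrary C), subset_univ _⟩
    · obtain ⟨c, U, hU, hz⟩ := hcov k hk v.2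
      refine ⟨c, U, hU, Subset.trans (Metric.ball_subset_ball ?_) hz⟩
      rw [hv]
      have := hsucc k; have := hδr0 k
      linarith

theorem CapacityDimLE.exists_colouredCovers {Z : Type*} [PseudoMetricSpace Z] [BoundedSpace Z]
    [Nonempty Z] (hZ : Metric.diam (univ : Set Z) < 1) {n : ℕ} (hn : CapacityDimLE Z n) :
    ∃ ε : ℝ, 0 < ε ∧ ε < 1 ∧ ∃ r₀ : ℝ, 0 < r₀ ∧ ∀ r : ℝ, 0 < r → r < r₀ → r < ε / 4 →
      ∃ 𝒰 : ColouredCovers Z (Fin (n + 1)) r ε,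
        ∀ H : HyperbolicCone Z r, 𝒰.IsSubordinate H := by
  obtain ⟨δ, ⟨hδ0, hδ1⟩, τ₀, hτ₀, hW⟩ := hn
  refine ⟨δ / 64, by linarith, by linarith, τ₀, hτ₀, fun r hr hr0 hrε => ?_⟩
  have key : ∀ k : ℕ, ∃ W : Fin (n + 1) → Set (Set Z), 1 ≤ k →
      (∀ c, ∀ U ∈ W c, IsOpen U) ∧ (∀ c, ∀ U ∈ W c, U.Nonempty) ∧
      (∀ c, ∀ U ∈ W c, ∀ x ∈ U, ∀ y ∈ U, dist x y ≤ r ^ k / 4) ∧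
      (∀ c, ∀ U ∈ W c, ∀ V ∈ W c, U ≠ V → ∀ x ∈ U, ∀ y ∈ V, δ * r ^ k / 8 ≤ dist x y) ∧
      ∀ z : Z, ∃ c, ∃ U ∈ W c, Metric.ball z (δ * r ^ k / 8) ⊆ U := by
    intro k
    by_cases hk : 1 ≤ k
    · have hp : 0 < r ^ k := pow_pos hr k
      have hle : r ^ k ≤ r := pow_le_of_le_one hr.le (by linarith) (by omega)
      -- With mesh `τ = r ^ k / 4` the Lebesgue number is `δ τ = 2 s` for `s = δ r ^ k / 8`;
      -- shrinking costs half of it and restores openness.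
      obtain ⟨W, -, h2, h3, h4⟩ := hW (r ^ k / 4) ⟨by linarith, by linarith⟩
      obtain ⟨W', hW'⟩ := exists_separated_shrinking (s := δ * r ^ k / 8)
        (by have := mul_pos hδ0 hp; linarith) W h2 h3 (fun z => by
          obtain ⟨c, U, hU, hz⟩ := h4 z
          refine ⟨c, U, hU, ?_⟩
          have e : 2 * (δ * r ^ k / 8) = δ * (r ^ k / 4) := by ring
          rwa [e])
      exact ⟨W', fun _ => hW'⟩
    · exact ⟨fun _ => ∅, fun h => absurd h hk⟩
  choose W hW using key
  exact _root_.exists_colouredCovers hZ hr hδ1 hrε W (fun k hk => (hW k hk).1)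
    (fun k hk => (hW k hk).2.1) (fun k hk => (hW k hk).2.2.1) (fun k hk => (hW k hk).2.2.2.1)
    (fun k hk => (hW k hk).2.2.2.2)

/-! ### Betweenness of finite sets -/

namespace Finset

variable {α : Type*} [DecidableEq α] {P Q M : Finset α}

/-- In the metric given by the symmetric difference, `M` is between `P` and `Q` when no element is
changed on the way to `M` and changed back afterwards. -/
lemma card_symmDiff_add_of_between (h1 : P ∩ Q ⊆ M) (h2 : M ⊆ P ∪ Q) :
    (symmDiff P M).card + (symmDiff M Q).card = (symmDiff P Q).card := by
  have hd : Disjoint (symmDiff P M) (symmDiff M Q) := by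
    rw [Finset.disjoint_left]
    intro x hx hy
    have := @h1 x
    have := @h2 x
    simp only [mem_symmDiff, mem_inter, mem_union] at *
    tauto
  rw [← card_union_of_disjoint hd]
  congr 1
  ext x
  have := @h1 x
  have := @h2 x
  simp only [mem_symmDiff, mem_inter, mem_union] at *
  tauto

/-- Equality in the triangle inequality forces the two symmetric differences to be disjoint. -/
lemma between_of_card_symmDiff_add
    (h : (symmDiff P M).card + (symmDiff M Q).card = (symmDiff P Q).card) :
    P ∩ Q ⊆ M ∧ M ⊆ P ∪ Q := by
  have hle : (symmDiff P Q).card ≤ (symmDiff P M ∪ symmDiff M Q).card :=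
    card_le_card (symmDiff_triangle P M Q)
  have h3 := card_union_add_card_inter (symmDiff P M) (symmDiff M Q)
  have h4 : symmDiff P M ∩ symmDiff M Q = ∅ := card_eq_zero.mp (by omega)
  have h5 : ∀ x, ¬ (x ∈ symmDiff P M ∧ x ∈ symmDiff M Q) := fun x hx => by
    have := mem_inter.mpr hx
    rw [h4] at this
    exact notMem_empty x this
  constructor <;> intro x hx <;> have := h5 x <;>
    simp only [mem_symmDiff, mem_inter, mem_union] at * <;> tauto

/-- The number of the elements that separate `R` from both of `P` and `Q`. -/
def gap (P Q R : Finset α) : ℕ := (R \ (P ∪ Q)).card + ((P ∩ Q) \ R).card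

end Finset

/-! ### The coloured trees and their ancestor sets -/

namespace ColouredCovers

variable {Z : Type*} [PseudoMetricSpace Z] {C : Type*} {r ε : ℝ} (𝒰 : ColouredCovers Z C r ε)

variable {𝒰} in
lemma treeVertex_ext {c : C} {p q : 𝒰.TreeVertex c} (h1 : p.1 = q.1)
    (h2 : (p.2 : Set Z) = q.2) : p = q := by
  obtain ⟨k, U⟩ := p
  obtain ⟨l, V⟩ := q
  obtain rfl : k = l := h1
  obtain rfl : U = V := Subtype.ext h2
  rfl

variable {𝒰} in
lemma treeVertex_eq_of_level_eq {c : C} {p q : 𝒰.TreeVertex c} (h1 : p.1 = q.1)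
    (h2 : ((p.2 : Set Z) ∩ q.2).Nonempty) : p = q := by
  obtain ⟨k, U, hU⟩ := p
  obtain ⟨l, V, hV⟩ := q
  obtain rfl : k = l := h1
  have : U = V := by
    by_contra hne
    obtain ⟨x, hx, hy⟩ := h2
    exact Set.disjoint_left.mp (𝒰.disjoint k c hU hV hne) hx hy
  subst this
  rfl

variable {𝒰} in
-- A common point rules out the disjoint alternative in `nested`.
lemma thickening_subset_of_ne (hε : 0 < ε) (hr : 0 < r) {c : C} {p q : 𝒰.TreeVertex c}
    (hle : p.1 ≤ q.1) (hpq : p ≠ q) (h : ((p.2 : Set Z) ∩ q.2).Nonempty) :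
    Metric.thickening (ε * r ^ q.1) (q.2 : Set Z) ⊆ p.2 := by
  refine (𝒰.nested c p.1 q.1 p.2 q.2 p.2.2 q.2.2 hle fun he => hpq ?_).resolve_left fun hd => ?_
  · exact treeVertex_ext (congrArg Prod.fst he) (congrArg Prod.snd he)
  · obtain ⟨x, hx, hy⟩ := h
    exact Set.disjoint_left.mp hd
      (Metric.self_subset_thickening (mul_pos hε (pow_pos hr _)) _ hy) hx

variable {𝒰} in
lemma subset_of_level_le (hε : 0 < ε) (hr : 0 < r) {c : C} {p q : 𝒰.TreeVertex c}
    (hle : p.1 ≤ q.1) (h : ((p.2 : Set Z) ∩ q.2).Nonempty) : (q.2 : Set Z) ⊆ p.2 := by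
  by_cases hpq : p = q
  · rw [hpq]
  · exact (Metric.self_subset_thickening (mul_pos hε (pow_pos hr _)) _).trans
      (thickening_subset_of_ne hε hr hle hpq h)

lemma treeVertex_nonempty {c : C} (p : 𝒰.TreeVertex c) : (p.2 : Set Z).Nonempty :=
  𝒰.nonempty _ _ _ p.2.2

lemma inter_nonempty_of_subset {c : C} {p q s : 𝒰.TreeVertex c} (h1 : (s.2 : Set Z) ⊆ p.2)
    (h2 : (s.2 : Set Z) ⊆ q.2) : ((p.2 : Set Z) ∩ q.2).Nonempty :=
  (𝒰.treeVertex_nonempty s).mono (subset_inter h1 h2)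

lemma finite_of_mem_of_level_le {c : C} (x : Z) (k : ℕ) :
    {q : 𝒰.TreeVertex c | q.1 ≤ k ∧ x ∈ (q.2 : Set Z)}.Finite := by
  refine Set.Finite.of_injOn (f := Sigma.fst) (t := Set.Iic k) (fun q hq => hq.1) ?_
    (Set.finite_Iic k)
  exact fun q hq s hs h => treeVertex_eq_of_level_eq h ⟨x, hq.2, hs.2⟩

lemma finite_ancestors {c : C} (p : 𝒰.TreeVertex c) :
    {q : 𝒰.TreeVertex c | q.1 ≤ p.1 ∧ (p.2 : Set Z) ⊆ q.2}.Finite := by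
  obtain ⟨x, hx⟩ := 𝒰.treeVertex_nonempty p
  exact (𝒰.finite_of_mem_of_level_le x p.1).subset fun q hq => ⟨hq.1, hq.2 hx⟩

/-- The vertices on the path of the tree from the root to `p`. -/
noncomputable def ancestors {c : C} (p : 𝒰.TreeVertex c) : Finset (𝒰.TreeVertex c) :=
  (𝒰.finite_ancestors p).toFinset

variable {𝒰} in
lemma mem_ancestors {c : C} {p q : 𝒰.TreeVertex c} :
    q ∈ 𝒰.ancestors p ↔ q.1 ≤ p.1 ∧ (p.2 : Set Z) ⊆ q.2 := by
  simp [ancestors]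

lemma self_mem_ancestors {c : C} (p : 𝒰.TreeVertex c) : p ∈ 𝒰.ancestors p :=
  mem_ancestors.mpr ⟨le_rfl, Subset.rfl⟩

lemma root_mem_ancestors {c : C} (p : 𝒰.TreeVertex c) : 𝒰.root c ∈ 𝒰.ancestors p :=
  mem_ancestors.mpr ⟨Nat.zero_le _, subset_univ _⟩

variable {𝒰} in
lemma ancestors_subset {c : C} {p q : 𝒰.TreeVertex c} (h : q ∈ 𝒰.ancestors p) :
    𝒰.ancestors q ⊆ 𝒰.ancestors p := fun s hs => by
  rw [mem_ancestors] at *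
  exact ⟨hs.1.trans h.1, h.2.trans hs.2⟩

variable {𝒰} in
lemma level_lt_of_mem_ancestors {c : C} {p q : 𝒰.TreeVertex c} (h : q ∈ 𝒰.ancestors p)
    (hne : q ≠ p) : q.1 < p.1 := by
  rw [mem_ancestors] at h
  exact h.1.lt_of_ne fun he => hne (treeVertex_eq_of_level_eq he
    (𝒰.inter_nonempty_of_subset h.2 Subset.rfl))

variable {𝒰} in
-- Ancestor sets are chains: two ancestors of `p` both contain the nonempty set of `p`, so they meet
-- and are nested.
lemma mem_ancestors_of_level_le (hε : 0 < ε) (hr : 0 < r) {c : C} {p q s : 𝒰.TreeVertex c}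
    (hq : q ∈ 𝒰.ancestors p) (hs : s ∈ 𝒰.ancestors p) (hle : s.1 ≤ q.1) :
    s ∈ 𝒰.ancestors q := by
  rw [mem_ancestors] at *
  exact ⟨hle, subset_of_level_le hε hr hle (𝒰.inter_nonempty_of_subset hs.2 hq.2)⟩

variable {𝒰} in
lemma tree_adj_of_level_lt {c : C} {p q : 𝒰.TreeVertex c} (h : (𝒰.tree c).Adj p q)
    (hlt : p.1 < q.1) : (q.2 : Set Z) ⊆ p.2 ∧
      ∀ s : 𝒰.TreeVertex c, (q.2 : Set Z) ⊆ s.2 → s.1 < q.1 → s.1 ≤ p.1 := by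
  rw [tree, SimpleGraph.fromRel_adj] at h
  rcases h with ⟨-, ⟨-, h1, h2⟩ | ⟨h0, -⟩⟩
  · exact ⟨h1, fun s hs hl => not_lt.mp fun hps => h2 ⟨s, hs, hps, hl⟩⟩
  · omega

variable {𝒰} in
lemma level_ne_of_tree_adj {c : C} {p q : 𝒰.TreeVertex c} (h : (𝒰.tree c).Adj p q) :
    p.1 ≠ q.1 := by
  rw [tree, SimpleGraph.fromRel_adj] at h
  rcases h with ⟨-, ⟨h0, -⟩ | ⟨h0, -⟩⟩ <;> omega

variable {𝒰} in
-- Parents are unique: both contain `q` and have the greatest level below that of `q` for which this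
-- is possible.
lemma eq_of_tree_adj {c : C} {p p' q : 𝒰.TreeVertex c} (h : (𝒰.tree c).Adj p q)
    (h' : (𝒰.tree c).Adj p' q) (hlt : p.1 < q.1) (hlt' : p'.1 < q.1) : p = p' := by
  obtain ⟨h1, h2⟩ := tree_adj_of_level_lt h hlt
  obtain ⟨h3, h4⟩ := tree_adj_of_level_lt h' hlt'
  exact treeVertex_eq_of_level_eq (le_antisymm (h4 p h1 hlt) (h2 p' h3 hlt'))
    (𝒰.inter_nonempty_of_subset h1 h3)

/-- On a cycle, a vertex of greatest level would have two distinct neighbours of smaller level,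
against the uniqueness of parents. -/
theorem tree_isTree (c : C) : (𝒰.tree c).IsTree := by
  classical
  refine ⟨𝒰.tree_connected c, fun v w hw => ?_⟩
  obtain ⟨u, hu, hmax⟩ := Finset.exists_max_image w.support.toFinset (fun p => p.1)
    ⟨v, by simp⟩
  rw [List.mem_toFinset] at hu
  have hc := hw.rotate hu
  set w' := w.rotate u hu
  have hlev : ∀ p ∈ w'.support, p.1 ≤ u.1 := fun p hp =>
    hmax p (by rw [List.mem_toFinset]; exact (w.mem_support_rotate_iff u hu).mp hp)
  have h1 : (𝒰.tree c).Adj u w'.snd := w'.adj_snd hc.not_nil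
  have h2 : (𝒰.tree c).Adj w'.penultimate u := w'.adj_penultimate hc.not_nil
  refine hc.snd_ne_penultimate (eq_of_tree_adj h1.symm h2 ?_ ?_)
  · exact (hlev _ (w'.getVert_mem_support 1)).lt_of_ne (level_ne_of_tree_adj h1.symm)
  · exact (hlev _ (w'.getVert_mem_support _)).lt_of_ne (level_ne_of_tree_adj h2)

open Classical in
variable {𝒰} in
lemma ancestors_eq_insert (hε : 0 < ε) (hr : 0 < r) {c : C} {p q : 𝒰.TreeVertex c}
    (h : (𝒰.tree c).Adj p q) (hlt : p.1 < q.1) :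
    𝒰.ancestors q = insert q (𝒰.ancestors p) ∧ q ∉ 𝒰.ancestors p := by
  obtain ⟨h1, h2⟩ := tree_adj_of_level_lt h hlt
  have hp : p ∈ 𝒰.ancestors q := mem_ancestors.mpr ⟨hlt.le, h1⟩
  refine ⟨?_, fun hq => by have := (mem_ancestors.mp hq).1; omega⟩
  ext s
  rw [Finset.mem_insert]
  constructor
  · intro hs
    by_cases hsq : s = q
    · exact .inl hsq
    · have := level_lt_of_mem_ancestors hs hsq
      exact .inr (mem_ancestors_of_level_le hε hr hp hs (h2 s (mem_ancestors.mp hs).2 this))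
  · rintro (rfl | hs)
    · exact 𝒰.self_mem_ancestors s
    · exact ancestors_subset hp hs

open Classical in
variable {𝒰} in
-- Crossing an edge adds or removes a single ancestor.
lemma card_symmDiff_ancestors_le_length (hε : 0 < ε) (hr : 0 < r) {c : C}
    {p q : 𝒰.TreeVertex c} (w : (𝒰.tree c).Walk p q) :
    (symmDiff (𝒰.ancestors p) (𝒰.ancestors q)).card ≤ w.length := by
  induction w with
  | nil => simp
  | @cons p s q h w ih =>
    have h1 : (symmDiff (𝒰.ancestors p) (𝒰.ancestors s)).card ≤ 1 := by
      rcases (level_ne_of_tree_adj h).lt_or_gt with hlt | hlt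
      · obtain ⟨e, -⟩ := ancestors_eq_insert hε hr h hlt
        rw [e]
        refine (Finset.card_le_card (t := {s}) fun x hx => ?_).trans (by simp)
        simp only [Finset.mem_symmDiff, Finset.mem_insert, Finset.mem_singleton] at *
        tauto
      · obtain ⟨e, -⟩ := ancestors_eq_insert hε hr h.symm hlt
        rw [e]
        refine (Finset.card_le_card (t := {p}) fun x hx => ?_).trans (by simp)
        simp only [Finset.mem_symmDiff, Finset.mem_insert, Finset.mem_singleton] at *
        tauto
    have h2 := Finset.card_le_card
      (symmDiff_triangle (𝒰.ancestors p) (𝒰.ancestors s) (𝒰.ancestors q))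
    have h3 := Finset.card_union_le (symmDiff (𝒰.ancestors p) (𝒰.ancestors s))
      (symmDiff (𝒰.ancestors s) (𝒰.ancestors q))
    rw [SimpleGraph.Walk.length_cons]
    have h4 : (symmDiff (𝒰.ancestors p) (𝒰.ancestors q)).card ≤
      (symmDiff (𝒰.ancestors p) (𝒰.ancestors s) ∪
        symmDiff (𝒰.ancestors s) (𝒰.ancestors q)).card := h2
    omega

variable {𝒰} in
-- The parent is the proper ancestor of greatest level.
lemma exists_parent {c : C} {a p : 𝒰.TreeVertex c} (h : a ∈ 𝒰.ancestors p) (hne : a ≠ p) :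
    ∃ q, (𝒰.tree c).Adj q p ∧ q.1 < p.1 ∧ a.1 ≤ q.1 := by
  classical
  obtain ⟨q, hq, hmax⟩ := Finset.exists_max_image ((𝒰.ancestors p).erase p) (fun s => s.1)
    ⟨a, Finset.mem_erase.mpr ⟨hne, h⟩⟩
  obtain ⟨hqp, hq⟩ := Finset.mem_erase.mp hq
  have hlt := level_lt_of_mem_ancestors hq hqp
  refine ⟨q, ?_, hlt, hmax a (Finset.mem_erase.mpr ⟨hne, h⟩)⟩
  rw [tree, SimpleGraph.fromRel_adj]
  refine ⟨hqp, .inl ⟨hlt, (mem_ancestors.mp hq).2, ?_⟩⟩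
  rintro ⟨s, h1, h2, h3⟩
  have := hmax s (Finset.mem_erase.mpr ⟨fun he => by rw [he] at h3; omega,
    mem_ancestors.mpr ⟨h3.le, h1⟩⟩)
  omega

open Classical in
variable {𝒰} in
-- Passing from `p` to its parent drops exactly one ancestor; repeat until `a` is reached.
lemma dist_le_card_ancestors_sdiff (hε : 0 < ε) (hr : 0 < r) {c : C} {a : 𝒰.TreeVertex c} :
    ∀ (k : ℕ) (p : 𝒰.TreeVertex c), p.1 = k → a ∈ 𝒰.ancestors p →
      (𝒰.tree c).dist p a ≤ (𝒰.ancestors p \ 𝒰.ancestors a).card := by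
  intro k
  induction k using Nat.strong_induction_on with
  | _ k ih =>
    intro p hp ha
    by_cases hap : a = p
    · rw [hap, SimpleGraph.dist_self]; exact Nat.zero_le _
    obtain ⟨q, hadj, hlt, haq⟩ := exists_parent ha hap
    obtain ⟨e, hnot⟩ := ancestors_eq_insert hε hr hadj hlt
    have hq : q ∈ 𝒰.ancestors p := by
      rw [e]; exact Finset.mem_insert_of_mem (𝒰.self_mem_ancestors q)
    have haq' := mem_ancestors_of_level_le hε hr hq ha haq
    have h1 := ih q.1 (by omega) q rfl haq'
    have h2 : (𝒰.tree c).dist p a ≤ (𝒰.tree c).dist p q + (𝒰.tree c).dist q a :=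
      (𝒰.tree_connected c).dist_triangle
    rw [SimpleGraph.dist_eq_one_iff_adj.mpr hadj.symm] at h2
    have hpa : p ∉ 𝒰.ancestors a := fun h => hnot (ancestors_subset haq' h)
    rw [e, Finset.insert_sdiff_of_notMem _ hpa, Finset.card_insert_of_notMem
      fun h => hnot (Finset.mem_sdiff.mp h).1]
    omega

open Classical in
-- Ancestor sets are initial segments, so the common ancestor of greatest level has all the others
-- among its ancestors.
lemma exists_ancestors_eq_inter (hε : 0 < ε) (hr : 0 < r) {c : C} (p q : 𝒰.TreeVertex c) :
    ∃ a, 𝒰.ancestors a = 𝒰.ancestors p ∩ 𝒰.ancestors q := by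
  obtain ⟨a, ha, hmax⟩ := Finset.exists_max_image (𝒰.ancestors p ∩ 𝒰.ancestors q)
    (fun s => s.1) ⟨𝒰.root c, Finset.mem_inter.mpr
      ⟨𝒰.root_mem_ancestors p, 𝒰.root_mem_ancestors q⟩⟩
  have ha' := Finset.mem_inter.mp ha
  refine ⟨a, Finset.Subset.antisymm (Finset.subset_inter (ancestors_subset ha'.1)
    (ancestors_subset ha'.2)) fun s hs => ?_⟩
  exact mem_ancestors_of_level_le hε hr ha'.1 (Finset.mem_inter.mp hs).1 (hmax s hs)

open Classical in
-- The upper bound comes from the route through the meet of `p` and `q`, the lower bound from the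
-- change of one ancestor per edge.
theorem tree_dist_eq (hε : 0 < ε) (hr : 0 < r) {c : C} (p q : 𝒰.TreeVertex c) :
    (𝒰.tree c).dist p q = (symmDiff (𝒰.ancestors p) (𝒰.ancestors q)).card := by
  apply le_antisymm
  · obtain ⟨a, ha⟩ := 𝒰.exists_ancestors_eq_inter hε hr p q
    have hmem : a ∈ 𝒰.ancestors p ∩ 𝒰.ancestors q := ha ▸ 𝒰.self_mem_ancestors a
    have h1 := dist_le_card_ancestors_sdiff hε hr _ p rfl (Finset.mem_inter.mp hmem).1
    have h2 := dist_le_card_ancestors_sdiff hε hr _ q rfl (Finset.mem_inter.mp hmem).2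
    have h3 : (𝒰.tree c).dist p q ≤ (𝒰.tree c).dist p a + (𝒰.tree c).dist a q :=
      (𝒰.tree_connected c).dist_triangle
    rw [SimpleGraph.dist_comm (u := a)] at h3
    rw [ha, Finset.sdiff_inter_self_left] at h1
    rw [ha, Finset.sdiff_inter_self_right] at h2
    have h4 : (symmDiff (𝒰.ancestors p) (𝒰.ancestors q)).card =
        (𝒰.ancestors p \ 𝒰.ancestors q).card + (𝒰.ancestors q \ 𝒰.ancestors p).card := by
      rw [symmDiff_def]
      exact Finset.card_union_of_disjoint disjoint_sdiff_sdiff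
    omega
  · obtain ⟨w, hw⟩ := (𝒰.tree_connected c).exists_walk_length_eq_dist p q
    rw [← hw]
    exact card_symmDiff_ancestors_le_length hε hr w

open Classical in
-- Any two of the three pairwise meets are ancestors of a common vertex among `x`, `y`, `z`, so
-- their ancestor sets are comparable. The union is the ancestor set of the deepest meet.
lemma exists_ancestors_eq_majority (hε : 0 < ε) (hr : 0 < r) {c : C}
    (x y z : 𝒰.TreeVertex c) : ∃ m, 𝒰.ancestors m =
      𝒰.ancestors x ∩ 𝒰.ancestors y ∪ 𝒰.ancestors y ∩ 𝒰.ancestors z ∪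
        𝒰.ancestors x ∩ 𝒰.ancestors z := by
  obtain ⟨a, ha⟩ := 𝒰.exists_ancestors_eq_inter hε hr x y
  obtain ⟨b, hb⟩ := 𝒰.exists_ancestors_eq_inter hε hr y z
  obtain ⟨e, he⟩ := 𝒰.exists_ancestors_eq_inter hε hr x z
  have ha' := Finset.mem_inter.mp (ha ▸ 𝒰.self_mem_ancestors a)
  have hb' := Finset.mem_inter.mp (hb ▸ 𝒰.self_mem_ancestors b)
  have he' := Finset.mem_inter.mp (he ▸ 𝒰.self_mem_ancestors e)
  have hmono : ∀ {p q s : 𝒰.TreeVertex c}, q ∈ 𝒰.ancestors p → s ∈ 𝒰.ancestors p →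
      s.1 ≤ q.1 → 𝒰.ancestors s ⊆ 𝒰.ancestors q := fun hq hs hle =>
    ancestors_subset (mem_ancestors_of_level_le hε hr hq hs hle)
  rw [← ha, ← hb, ← he]
  by_cases h1 : b.1 ≤ a.1 ∧ e.1 ≤ a.1
  · have := hmono ha'.2 hb'.1 h1.1
    have := hmono ha'.1 he'.1 h1.2
    exact ⟨a, by rw [Finset.union_eq_left.mpr ‹𝒰.ancestors b ⊆ _›, Finset.union_eq_left.mpr this]⟩
  by_cases h2 : a.1 ≤ b.1 ∧ e.1 ≤ b.1
  · have := hmono hb'.1 ha'.2 h2.1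
    have := hmono hb'.2 he'.2 h2.2
    exact ⟨b, by rw [Finset.union_eq_right.mpr ‹𝒰.ancestors a ⊆ _›, Finset.union_eq_left.mpr this]⟩
  · have h3 : a.1 ≤ e.1 ∧ b.1 ≤ e.1 := by omega
    have := hmono he'.1 ha'.1 h3.1
    have := hmono he'.2 hb'.2 h3.2
    exact ⟨e, (Finset.union_eq_right.mpr (Finset.union_subset ‹_› ‹_›)).symm⟩

open Classical in
/-- Each vertex of the tree is near the median of three vertices, if few ancestor sets
separate it from two of the three. -/
theorem dist_graphMedian_le (hε : 0 < ε) (hr : 0 < r) {c : C} (x y z w : 𝒰.TreeVertex c) :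
    (𝒰.tree c).dist w (graphMedian (𝒰.tree c) x y z) ≤
      Finset.gap (𝒰.ancestors x) (𝒰.ancestors y) (𝒰.ancestors w) +
      Finset.gap (𝒰.ancestors y) (𝒰.ancestors z) (𝒰.ancestors w) +
      Finset.gap (𝒰.ancestors x) (𝒰.ancestors z) (𝒰.ancestors w) := by
  have hex : ∃ m, IsGraphMedian (𝒰.tree c) x y z m := by
    obtain ⟨m, hm⟩ := 𝒰.exists_ancestors_eq_majority hε hr x y z
    refine ⟨m, ?_⟩
    simp only [IsGraphMedian, 𝒰.tree_dist_eq hε hr]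
    refine ⟨?_, ?_, ?_⟩ <;> apply Finset.card_symmDiff_add_of_between <;> rw [hm] <;>
      intro s hs <;> simp only [Finset.mem_union, Finset.mem_inter] at * <;> tauto
  rw [graphMedian, dif_pos hex]
  have hspec := hex.choose_spec
  set m := hex.choose
  simp only [IsGraphMedian, 𝒰.tree_dist_eq hε hr] at hspec
  obtain ⟨h1, h2⟩ := Finset.between_of_card_symmDiff_add hspec.1
  obtain ⟨h3, h4⟩ := Finset.between_of_card_symmDiff_add hspec.2.1
  obtain ⟨h5, h6⟩ := Finset.between_of_card_symmDiff_add hspec.2.2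
  rw [𝒰.tree_dist_eq hε hr]
  generalize 𝒰.ancestors x = X at *
  generalize 𝒰.ancestors y = Y at *
  generalize 𝒰.ancestors z = V at *
  generalize 𝒰.ancestors w = W at *
  generalize 𝒰.ancestors m = M at *
  -- Betweenness pins `M` down to the majority set. An element of `W` outside `M` is missing from
  -- two of `X`, `Y`, `V`, and an element of `M` outside `W` lies in two of them; either way it
  -- counts in some gap.
  have hsub : symmDiff W M ⊆ ((W \ (X ∪ Y) ∪ (X ∩ Y) \ W) ∪ (W \ (Y ∪ V) ∪ (Y ∩ V) \ W)) ∪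
      (W \ (X ∪ V) ∪ (X ∩ V) \ W) := by
    intro s hs
    have := @h1 s; have := @h2 s; have := @h3 s; have := @h4 s; have := @h5 s; have := @h6 s
    clear h1 h2 h3 h4 h5 h6
    simp only [Finset.mem_union, Finset.mem_inter, Finset.mem_sdiff, Finset.mem_symmDiff] at *
    grind
  refine (Finset.card_le_card hsub).trans ((Finset.card_union_le _ _).trans (add_le_add
    ((Finset.card_union_le _ _).trans (add_le_add ?_ ?_)) ?_)) <;> exact Finset.card_union_le _ _

/-- The ancestors of the image of a vertex `v` of the cone are the members of lower levels that
contain the ball of `v` (together with the root). -/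
theorem mem_ancestors_vertexMap (hε : 0 < ε) (hr : 0 < r) {H : HyperbolicCone Z r} {c : C}
    {v : H.Vertex} {q : 𝒰.TreeVertex c} :
    q ∈ 𝒰.ancestors (𝒰.vertexMap c v) ↔ q.1 ≤ v.1 - 1 ∧ v.ball ⊆ q.2 := by
  classical
  have hsub : v.ball ⊆ (𝒰.exists_image c v).choose := (𝒰.exists_image c v).choose_spec.2
  refine Iff.trans mem_ancestors ?_
  constructor
  · rintro ⟨h1, h2⟩
    refine ⟨le_trans (show q.1 ≤ 𝒰.imageLevel c v from h1) ?_, hsub.trans h2⟩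
    exact Nat.findGreatest_le _
  · rintro ⟨h1, h2⟩
    -- Truncated subtraction in `v.1 - 1` leaves only the root when `v` has level zero. The centre
    -- of `v` is a common point that makes the two members nested.
    have h3 : q.1 ≤ 𝒰.imageLevel c v := Nat.le_findGreatest h1 ⟨q.2, q.2.2, h2⟩
    refine ⟨h3, subset_of_level_le (q := (𝒰.vertexMap c v : 𝒰.TreeVertex c)) hε hr h3
      ⟨v.2, h2 ?_, hsub ?_⟩⟩ <;>
    exact Metric.mem_ball_self (mul_pos two_pos (pow_pos hr _))

end ColouredCovers

/-! ### Medians in median graphs and coarse identities of coarse medians -/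

lemma IsMedianGraph.graphMedian_spec {V : Type*} {G : SimpleGraph V} (hG : IsMedianGraph G)
    (a b c : V) : IsGraphMedian G a b c (graphMedian G a b c) := by
  rw [graphMedian, dif_pos (hG.2 a b c).exists]
  exact (hG.2 a b c).exists.choose_spec

lemma IsMedianGraph.graphMedian_eq {V : Type*} {G : SimpleGraph V} (hG : IsMedianGraph G)
    {a b c m : V} (h : IsGraphMedian G a b c m) : graphMedian G a b c = m :=
  (hG.2 a b c).unique (hG.graphMedian_spec a b c) h

lemma IsMedianGraph.graphMedian_of_between {V : Type*} {G : SimpleGraph V} (hG : IsMedianGraph G)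
    {a b m : V} (h : G.dist a m + G.dist m b = G.dist a b) : graphMedian G a b m = m :=
  hG.graphMedian_eq ⟨h, by simp, by simp⟩

lemma IsMedianGraph.graphMedian_rotate {V : Type*} {G : SimpleGraph V} (hG : IsMedianGraph G)
    (a b c : V) : graphMedian G b c a = graphMedian G a b c := by
  obtain ⟨h1, h2, h3⟩ := hG.graphMedian_spec a b c
  refine hG.graphMedian_eq ⟨h2, ?_, ?_⟩
  · rw [G.dist_comm (u := c), G.dist_comm (v := a), G.dist_comm (u := c), add_comm]; exact h3
  · rw [G.dist_comm (u := b), G.dist_comm (v := a), G.dist_comm (u := b), add_comm]; exact h1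

/-- The points `a`, `s`, `m`, `t`, `b` lie in this order on a geodesic, so `m` is between `s` and
`t`. -/
lemma IsMedianGraph.graphMedian_nested {V : Type*} {G : SimpleGraph V} (hG : IsMedianGraph G)
    (a b c x y : V) :
    graphMedian G (graphMedian G a (graphMedian G a b c) x) (graphMedian G a b c)
      (graphMedian G (graphMedian G a b c) b y) = graphMedian G a b c := by
  have h0 := (hG.graphMedian_spec a b c).1
  set m := graphMedian G a b c
  have h1 := (hG.graphMedian_spec a m x).1
  set s := graphMedian G a m x
  have h2 := (hG.graphMedian_spec m b y).1
  set t := graphMedian G m b y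
  have h3 : G.dist a b ≤ G.dist a s + G.dist s b := hG.1.dist_triangle
  have h4 : G.dist s b ≤ G.dist s t + G.dist t b := hG.1.dist_triangle
  have h5 : G.dist s t ≤ G.dist s m + G.dist m t := hG.1.dist_triangle
  exact hG.graphMedian_eq ⟨by simp, by simp, by omega⟩

/-- Coarse versions of identities in median algebras. -/
structure CoarseMedianIdentities {X : Type*} [PseudoMetricSpace X] (μ : X → X → X → X)
    (C : ℝ) : Prop where
  nonneg : 0 ≤ C
  lipschitz : ∀ x x' y y' z z',
    dist (μ x y z) (μ x' y' z') ≤ C * (1 + dist x x' + dist y y' + dist z z')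
  left : ∀ a b, dist (μ a b a) a ≤ C
  right : ∀ a b, dist (μ a b b) b ≤ C
  idem : ∀ a b x, dist (μ a b (μ a b x)) (μ a b x) ≤ C
  nested : ∀ a b c x y, dist (μ a b c) (μ (μ a (μ a b c) x) (μ a b c) (μ (μ a b c) b y)) ≤ C

/-- The identities involve at most five points and hold exactly in the median graph approximating
them; they are transferred along the approximation. -/
lemma IsCoarseMedian.exists_identities {X : Type*} [PseudoMetricSpace X] {μ : X → X → X → X}
    (hμ : IsCoarseMedian μ) : ∃ C, CoarseMedianIdentities μ C := by
  classical
  obtain ⟨h, hlip, hfin⟩ := hμ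
  rcases isEmpty_or_nonempty X with hX | ⟨⟨o⟩⟩
  · exact ⟨0, le_rfl, fun x => hX.elim x, fun x => hX.elim x, fun x => hX.elim x,
      fun x => hX.elim x, fun x => hX.elim x⟩
  set κ := h 1
  set E := h 5
  have hκ : 0 ≤ κ := by
    have := hlip o o o o o o
    simp only [dist_self] at this
    linarith
  have hE : 0 ≤ E := by
    obtain ⟨N, Q, -, p, q, -, h2⟩ := hfin 5 {o} (by simp)
    exact dist_nonneg.trans (h2 ⟨o, by simp⟩)
  -- The errors `e₁`, `e₂`, `e₃` are those after one, two and three nested medians.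
  obtain ⟨e₁, he₁⟩ : ∃ e, e = E + κ * (1 + E + E + E) := ⟨_, rfl⟩
  obtain ⟨e₂, he₂⟩ : ∃ e, e = E + κ * (1 + E + e₁ + E) := ⟨_, rfl⟩
  obtain ⟨e₃, he₃⟩ : ∃ e, e = E + κ * (1 + e₂ + e₁ + e₂) := ⟨_, rfl⟩
  have h1 : 0 ≤ e₁ := by rw [he₁]; positivity
  have h2 : 0 ≤ e₂ := by rw [he₂]; positivity
  have h3 : 0 ≤ e₃ := by rw [he₃]; positivity
  have key : ∀ a b c x y : X,
      dist (μ a b a) a ≤ e₁ + E ∧ dist (μ a b b) b ≤ e₁ + E ∧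
      dist (μ a b (μ a b c)) (μ a b c) ≤ e₂ + e₁ ∧
      dist (μ a b c) (μ (μ a (μ a b c) x) (μ a b c) (μ (μ a b c) b y)) ≤ e₁ + e₃ := by
    intro a b c x y
    obtain ⟨N, Q, hQ, p, q, hq, hp⟩ := hfin 5 {a, b, c, x, y} Finset.card_le_five
    have approx : ∀ v₁ v₂ v₃ x₁ x₂ x₃ f₁ f₂ f₃, dist (q v₁) x₁ ≤ f₁ → dist (q v₂) x₂ ≤ f₂ →
        dist (q v₃) x₃ ≤ f₃ →
        dist (q (graphMedian Q v₁ v₂ v₃)) (μ x₁ x₂ x₃) ≤ E + κ * (1 + f₁ + f₂ + f₃) := by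
      intro v₁ v₂ v₃ x₁ x₂ x₃ f₁ f₂ f₃ i₁ i₂ i₃
      refine (dist_triangle _ _ _).trans (add_le_add (hq v₁ v₂ v₃)
        ((hlip _ _ _ _ _ _).trans (mul_le_mul_of_nonneg_left ?_ hκ)))
      linarith
    obtain ⟨A, hA⟩ : ∃ v, dist (q v) a ≤ E := ⟨_, (dist_comm _ _).trans_le (hp ⟨a, by simp⟩)⟩
    obtain ⟨B, hB⟩ : ∃ v, dist (q v) b ≤ E := ⟨_, (dist_comm _ _).trans_le (hp ⟨b, by simp⟩)⟩
    obtain ⟨V, hV⟩ : ∃ v, dist (q v) c ≤ E := ⟨_, (dist_comm _ _).trans_le (hp ⟨c, by simp⟩)⟩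
    obtain ⟨S, hS⟩ : ∃ v, dist (q v) x ≤ E := ⟨_, (dist_comm _ _).trans_le (hp ⟨x, by simp⟩)⟩
    obtain ⟨T, hT⟩ : ∃ v, dist (q v) y ≤ E := ⟨_, (dist_comm _ _).trans_le (hp ⟨y, by simp⟩)⟩
    have hM := approx _ _ _ _ _ _ _ _ _ hA hB hV
    rw [← he₁] at hM
    refine ⟨?_, ?_, ?_, ?_⟩
    · have := approx _ _ _ _ _ _ _ _ _ hA hB hA
      rw [hQ.graphMedian_of_between (by simp), ← he₁] at this
      exact (dist_triangle_left _ _ _).trans (add_le_add this hA)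
    · have := approx _ _ _ _ _ _ _ _ _ hA hB hB
      rw [hQ.graphMedian_of_between (by simp), ← he₁] at this
      exact (dist_triangle_left _ _ _).trans (add_le_add this hB)
    · have := approx _ _ _ _ _ _ _ _ _ hA hB hM
      rw [hQ.graphMedian_of_between (hQ.graphMedian_spec A B V).1] at this
      refine (dist_triangle_left _ _ _).trans (add_le_add (this.trans ?_) hM)
      rw [he₂]; linarith
    · have hs := approx _ _ _ _ _ _ _ _ _ hA hM hS
      have ht := approx _ _ _ _ _ _ _ _ _ hM hB hT
      rw [← he₂] at hs
      have ht' : _ ≤ e₂ := ht.trans_eq (by rw [he₂]; ring)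
      have := approx _ _ _ _ _ _ _ _ _ hs hM ht'
      rw [hQ.graphMedian_nested, ← he₃] at this
      exact (dist_triangle_left _ _ _).trans (add_le_add hM this)
  refine ⟨κ + E + e₁ + e₂ + e₃, by positivity, ?_, ?_, ?_, ?_, ?_⟩
  · intro x x' y y' z z'
    refine (hlip x x' y y' z z').trans (mul_le_mul_of_nonneg_right (by linarith) (by positivity))
  · intro a b; have := (key a b a a a).1; linarith
  · intro a b; have := (key a b a a a).2.1; linarith
  · intro a b x; have := (key a b x a a).2.2.1; linarith
  · intro a b c x y; have := (key a b c x y).2.2.2; linarith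

/-- The bound on `excess` below concerns the first two arguments only; rotations give the other
pairs. -/
lemma IsCoarseMedian.rotate {X : Type*} [PseudoMetricSpace X] {μ : X → X → X → X}
    (hμ : IsCoarseMedian μ) : IsCoarseMedian fun x y z => μ y z x := by
  obtain ⟨h, hlip, hfin⟩ := hμ
  refine ⟨h, fun x x' y y' z z' => (hlip y y' z z' x x').trans_eq (by ring), fun n A hA => ?_⟩
  obtain ⟨N, Q, hQ, p, q, hq, hp⟩ := hfin n A hA
  refine ⟨N, Q, hQ, p, q, fun v₁ v₂ v₃ => ?_, hp⟩
  rw [← hQ.graphMedian_rotate]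
  exact hq v₂ v₃ v₁

/-- A coarse median can be transported to a coarsely dense subspace. -/
lemma IsCoarseMedian.transport {X Y : Type*} [PseudoMetricSpace X] [MetricSpace Y]
    {μ : X → X → X → X} (hμ : IsCoarseMedian μ) (i : Y → X) (hi : Isometry i) (π : X → Y)
    (hπ : ∀ x, dist (i (π x)) x ≤ 1) :
    IsCoarseMedian fun x y z => π (μ (i x) (i y) (i z)) := by
  classical
  obtain ⟨h, hlip, hfin⟩ := hμ
  have hπ' : ∀ x y, dist (π x) (π y) ≤ dist x y + 2 := fun x y => by
    rw [← hi.dist_eq]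
    have h1 := dist_triangle4 (i (π x)) x y (i (π y))
    have h2 := hπ x
    have h3 := hπ y
    rw [dist_comm] at h3
    linarith
  refine ⟨fun n => |h n| + 4 * |h 1| + 4, ?_, fun n A hA => ?_⟩
  · intro x x' y y' z z'
    have h1 := hlip (i x) (i x') (i y) (i y') (i z) (i z')
    rw [hi.dist_eq, hi.dist_eq, hi.dist_eq] at h1
    have h2 := hπ' (μ (i x) (i y) (i z)) (μ (i x') (i y') (i z'))
    have hS : 1 ≤ 1 + dist x x' + dist y y' + dist z z' := by
      have := dist_nonneg (x := x) (y := x'); have := dist_nonneg (x := y) (y := y')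
      have := dist_nonneg (x := z) (y := z'); linarith
    have h3 := mul_le_mul_of_nonneg_right
      (show h 1 + 2 ≤ |h 1| + 4 * |h 1| + 4 by
        have := le_abs_self (h 1); have := abs_nonneg (h 1); linarith) (zero_le_one.trans hS)
    linarith
  · obtain ⟨N, Q, hQ, p, q, hq, hp⟩ := hfin n (A.image i) (Finset.card_image_le.trans hA)
    refine ⟨N, Q, hQ, fun a => p ⟨i a, Finset.mem_image_of_mem i a.2⟩, π ∘ q, ?_, ?_⟩
    · intro v₁ v₂ v₃
      have h1 := hπ' (q (graphMedian Q v₁ v₂ v₃)) (μ (i (π (q v₁))) (i (π (q v₂))) (i (π (q v₃))))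
      have h2 := dist_triangle (q (graphMedian Q v₁ v₂ v₃)) (μ (q v₁) (q v₂) (q v₃))
        (μ (i (π (q v₁))) (i (π (q v₂))) (i (π (q v₃))))
      have h3 := hq v₁ v₂ v₃
      have h4 := hlip (q v₁) (i (π (q v₁))) (q v₂) (i (π (q v₂))) (q v₃) (i (π (q v₃)))
      have h5 : h 1 * (1 + dist (q v₁) (i (π (q v₁))) + dist (q v₂) (i (π (q v₂))) +
          dist (q v₃) (i (π (q v₃)))) ≤ |h 1| * 4 := by
        refine mul_le_mul (le_abs_self _) ?_ (by positivity) (abs_nonneg _)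
        have := hπ (q v₁); have := hπ (q v₂); have := hπ (q v₃)
        rw [dist_comm (q v₁), dist_comm (q v₂), dist_comm (q v₃)]
        linarith
      have h6 := le_abs_self (h n)
      simp only [Function.comp]
      linarith
    · intro a
      have h1 := hp ⟨i a, Finset.mem_image_of_mem i a.2⟩
      set v := p ⟨i a, Finset.mem_image_of_mem i a.2⟩
      have h2 := dist_triangle (i a) (q v) (i (π (q v)))
      have h3 := hπ (q v)
      rw [dist_comm] at h3
      rw [← hi.dist_eq]
      have h6 := le_abs_self (h n)
      have := abs_nonneg (h 1)
      simp only [Function.comp]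
      change dist (i a) (q v) ≤ h n at h1
      linarith

/-! ### Hyperbolic spaces -/

/-- Twice the Gromov product of `a` and `b` at `p`. -/
noncomputable def excess {X : Type*} [PseudoMetricSpace X] (a b p : X) : ℝ :=
  dist a p + dist p b - dist a b

/-- Gromov's four point condition. -/
def FourPoint (X : Type*) [PseudoMetricSpace X] (δ : ℝ) : Prop :=
  ∀ x y z w : X, dist x y + dist z w ≤ max (dist x z + dist y w) (dist x w + dist y z) + δ

/-- Any two points are joined by a geodesic with integer parameters. -/
def HasIntegerGeodesics (X : Type*) [PseudoMetricSpace X] : Prop :=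
  ∀ x y : X, ∃ (N : ℕ) (γ : ℕ → X), γ 0 = x ∧ (∀ i, N ≤ i → γ i = y) ∧
    (∀ i ≤ N, dist x (γ i) = i ∧ dist (γ i) y = N - i) ∧ ∀ i, dist (γ i) (γ (i + 1)) ≤ 1

section Hyperbolic

variable {X : Type*} [PseudoMetricSpace X]

lemma excess_comm (a b p : X) : excess a b p = excess b a p := by
  simp only [excess, dist_comm, add_comm]

lemma excess_nonneg (a b p : X) : 0 ≤ excess a b p := by
  have := dist_triangle a p b
  simp only [excess]; linarith

/-- Subtract the four point inequality from `dist x p + dist y p + dist z p`. As `excess` is twice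
the Gromov product, the constant stays `δ`. -/
lemma FourPoint.min_excess_le {δ : ℝ} (h : FourPoint X δ) (x y z p : X) :
    min (excess x z p) (excess z y p) ≤ excess x y p + δ := by
  have h1 := h x y z p
  simp only [excess]
  rw [dist_comm p z, dist_comm z y, dist_comm p y] at *
  rcases max_cases (dist x z + dist y p) (dist x p + dist y z) with ⟨e, -⟩ | ⟨e, -⟩
  · refine (min_le_left _ _).trans ?_
    rw [e] at h1; linarith
  · refine (min_le_right _ _).trans ?_
    rw [e] at h1; linarith

/-- Exponential divergence: bisect the path `k` times, each time keeping a half whose excess at `p`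
grows by at most `δ`. A single step of length at most `L` remains. -/
lemma FourPoint.exists_dist_le {δ : ℝ} (h : FourPoint X δ) (p : X) {L : ℝ} (k : ℕ) :
    ∀ x : ℕ → X, (∀ i, dist (x i) (x (i + 1)) ≤ L) →
      ∃ i, dist p (x i) ≤ L + (excess (x 0) (x (2 ^ k)) p + k * δ) / 2 := by
  induction k with
  | zero =>
    intro x hx
    refine ⟨0, ?_⟩
    have h1 := hx 0
    have h2 := dist_triangle (x 0) (x 1) p
    simp only [excess, pow_zero, Nat.cast_zero, zero_add] at *
    rw [dist_comm p, dist_comm p]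
    linarith
  | succ k ih =>
    intro x hx
    have h1 := h.min_excess_le (x 0) (x (2 ^ (k + 1))) (x (2 ^ k)) p
    push_cast
    rcases min_le_iff.mp h1 with h2 | h2
    · obtain ⟨i, hi⟩ := ih x hx
      exact ⟨i, by linarith⟩
    · obtain ⟨i, hi⟩ := ih (fun j => x (2 ^ k + j)) (fun j => hx _)
      refine ⟨2 ^ k + i, ?_⟩
      have e : 2 ^ k + 2 ^ k = 2 ^ (k + 1) := by ring
      simp only [add_zero, e] at hi
      linarith

/-- The number of bisections of a path of length linear in `D` is logarithmic, so its cost can be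
kept below `D` plus a constant. Take `k` about `D / (δ + 1)` and use Bernoulli's inequality. -/
lemma exists_pow_two_bound (A B : ℝ) {δ : ℝ} (hδ : 0 ≤ δ) :
    ∃ C : ℝ, 0 ≤ C ∧ ∀ D : ℝ, 0 ≤ D → ∃ k : ℕ, A * D + B ≤ 2 ^ k ∧ k * δ ≤ D + C := by
  obtain ⟨n, hn⟩ := pow_unbounded_of_one_lt (max B (A * (δ + 1))) (one_lt_two (α := ℝ))
  refine ⟨(1 + n) * δ, by positivity, fun D hD => ⟨⌈D / (δ + 1)⌉₊ + n, ?_, ?_⟩⟩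
  · have h1 : D / (δ + 1) ≤ ⌈D / (δ + 1)⌉₊ := Nat.le_ceil _
    have h2 := one_add_mul_le_pow (show (-2 : ℝ) ≤ 1 by norm_num) ⌈D / (δ + 1)⌉₊
    norm_num at h2
    have h3 : 1 + D / (δ + 1) ≤ 2 ^ ⌈D / (δ + 1)⌉₊ := by linarith
    have h4 : A * D = A * (δ + 1) * (D / (δ + 1)) := by field_simp
    have h5 : 0 ≤ D / (δ + 1) := by positivity
    have h6 : A * (δ + 1) * (D / (δ + 1)) ≤ 2 ^ n * (D / (δ + 1)) :=
      mul_le_mul_of_nonneg_right ((le_max_right _ _).trans hn.le) h5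
    have h7 : B ≤ 2 ^ n := (le_max_left _ _).trans hn.le
    have h8 := mul_le_mul_of_nonneg_right h3 (show (0 : ℝ) ≤ 2 ^ n by positivity)
    rw [pow_add]
    linarith
  · have h1 : (⌈D / (δ + 1)⌉₊ : ℝ) < D / (δ + 1) + 1 := Nat.ceil_lt_add_one (by positivity)
    have h2 := mul_le_mul_of_nonneg_right h1.le hδ
    have h3 : D / (δ + 1) * δ ≤ D := by
      rw [div_mul_eq_mul_div, div_le_iff₀ (by linarith)]
      nlinarith
    push_cast
    linarith

/-- From a point `p` close to a geodesic from `e` to `f` go back by `2 D` towards `e`. -/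
lemma exists_back_point (hgeo : HasIntegerGeodesics X) {I : Set X} {e f p : X} {κ C D : ℝ}
    (hC : 0 ≤ C) (hD : 0 ≤ D) (hI : ∀ q, excess e f q ≤ κ → ∃ u ∈ I, dist q u ≤ D)
    (he : ∃ u ∈ I, dist e u ≤ C) (hp : excess e f p ≤ κ) :
    ∃ y, ∃ u ∈ I, dist e y + dist y p = dist e p ∧ dist y p ≤ 2 * D + 1 ∧ dist y u ≤ D + C ∧
      ∀ κ', excess y u p ≤ κ' → ∃ u' ∈ I, dist p u' ≤ κ' + C := by
  obtain ⟨N, γ, h0, hN, hγ, -⟩ := hgeo e p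
  have hceil : (⌈2 * D⌉₊ : ℝ) < 2 * D + 1 := Nat.ceil_lt_add_one (by linarith)
  have heN : dist e p = N := by
    have := (hγ N le_rfl).1
    rwa [hN N le_rfl] at this
  -- If there is room to go back by `2 D`, then `u` is within `D` of `y`, so the excess of `y`, `u`
  -- at `p` is at least `2 D` and a bound on it bounds `D` itself. Otherwise `y = e`, and `u` is
  -- within `C` of `e`.
  rcases le_or_gt ⌈2 * D⌉₊ N with hle | hlt
  · obtain ⟨h1, h2⟩ := hγ (N - ⌈2 * D⌉₊) (Nat.sub_le _ _)
    set y := γ (N - ⌈2 * D⌉₊)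
    rw [Nat.cast_sub hle] at h1 h2
    have h3 : 2 * D ≤ dist y p := by rw [h2]; have := Nat.le_ceil (2 * D); linarith
    have hy : dist e y + dist y p = dist e p := by rw [h1, h2, heN]; ring
    have hye : excess e f y ≤ κ := by
      have := dist_triangle y p f
      simp only [excess] at *
      linarith
    obtain ⟨u, hu, hyu⟩ := hI y hye
    refine ⟨y, u, hu, hy, by rw [h2]; linarith, by linarith, fun κ' h => ?_⟩
    obtain ⟨u', hu', hpu⟩ := hI p hp
    refine ⟨u', hu', ?_⟩
    have h4 := dist_triangle y u p
    have h5 := excess_nonneg y u p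
    rw [dist_comm u] at h4
    simp only [excess] at *
    linarith
  · obtain ⟨u, hu, heu⟩ := he
    refine ⟨e, u, hu, by rw [dist_self, zero_add], ?_, by linarith, fun κ' h => ⟨u, hu, ?_⟩⟩
    · rw [heN]
      have : (N : ℝ) ≤ ⌈2 * D⌉₊ := by exact_mod_cast hlt.le
      linarith
    · have := dist_nonneg (x := e) (y := p)
      simp only [excess] at h
      linarith

/-- The Morse argument with `range (μ a b)` in place of a quasigeodesic. A detour around `p` inside
the interval has length linear in `D`, and hyperbolicity lets it avoid `p` only by a logarithm of
that length, hence by `D / 2` plus a constant. -/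
lemma CoarseMedianIdentities.improve_bound {μ : X → X → X → X} {C δ : ℝ}
    (hμ : CoarseMedianIdentities μ C) (hδ0 : 0 ≤ δ) (hδ : FourPoint X δ)
    (hgeo : HasIntegerGeodesics X) {κ : ℝ} (hκ : 0 ≤ κ) :
    ∃ K : ℝ, 0 ≤ K ∧ ∀ a b : X, ∀ D, 0 ≤ D →
      (∀ p, excess a b p ≤ κ → ∃ u ∈ range (μ a b), dist p u ≤ D) →
      ∀ p, excess a b p ≤ κ → ∃ u ∈ range (μ a b), dist p u ≤ D / 2 + K := by
  have hC := hμ.nonneg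
  -- The distance from `u` to `v` via `y`, `p`, `z` is at most `2 (D + C) + 2 (2 D + 1) = 6 D + (2 C
  -- + 2)`.
  obtain ⟨C₁, hC₁, hlog⟩ := exists_pow_two_bound 6 (2 * C + 2) hδ0
  refine ⟨κ + 2 * δ + 4 * C + C₁, by positivity, fun a b D hD hI p hp => ?_⟩
  obtain ⟨y, u, hu, hy, hyp, hyu, hback⟩ := exists_back_point hgeo hC hD hI
    ⟨μ a b a, mem_range_self a, (dist_comm _ _).trans_le (hμ.left a b)⟩ hp
  obtain ⟨z, v, hv, hz, hzp, hzv, hback'⟩ := exists_back_point (e := b) (f := a) hgeo hC hD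
    (fun q hq => hI q (by rwa [excess_comm])) ⟨μ a b b, mem_range_self b,
      (dist_comm _ _).trans_le (hμ.right a b)⟩ (by rwa [excess_comm])
  have hyz : excess y z p ≤ κ := by
    have := dist_triangle4 a y z b
    simp only [excess] at *
    rw [dist_comm p z, dist_comm z b] at *
    rw [dist_comm p b] at hp
    linarith
  rcases min_le_iff.mp (hδ.min_excess_le y z u p) with h1 | h1
  · obtain ⟨u', hu', h⟩ := hback (κ + δ) (by linarith)
    exact ⟨u', hu', by linarith⟩
  rcases min_le_iff.mp (hδ.min_excess_le u z v p) with h2 | h2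
  swap
  · obtain ⟨u', hu', h⟩ := hback' (κ + 2 * δ) (by rw [excess_comm]; linarith)
    exact ⟨u', hu', by linarith⟩
  obtain ⟨N, γ, h0, hN, hγ, hstep⟩ := hgeo u v
  have huv : dist u v = N := by
    have := (hγ N le_rfl).1
    rwa [hN N le_rfl] at this
  have huv' : dist u v ≤ 6 * D + (2 * C + 2) := by
    have e1 := dist_triangle4 u y z v
    have e2 := dist_triangle y p z
    rw [dist_comm u y] at e1
    rw [dist_comm p z] at e2
    linarith
  obtain ⟨k, hk1, hk2⟩ := hlog D hD
  have hNk : N ≤ 2 ^ k := by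
    have : (N : ℝ) ≤ 2 ^ k := by rw [← huv]; linarith
    exact_mod_cast this
  -- Applying `μ a b` to a geodesic from `u` to `v` gives a path in the interval with steps at most
  -- `2 C`; its ends are within `C` of `u` and `v` by `idem`.
  obtain ⟨i, hi⟩ := hδ.exists_dist_le p (L := 2 * C) k (fun i => μ a b (γ i)) fun i => by
    have e1 := hμ.lipschitz a a b b (γ i) (γ (i + 1))
    have e2 := mul_le_mul_of_nonneg_left (hstep i) hC
    rw [dist_self, dist_self] at e1
    linarith
  refine ⟨_, mem_range_self (γ i), hi.trans ?_⟩
  have hex : excess (μ a b (γ 0)) (μ a b (γ (2 ^ k))) p ≤ excess u v p + 4 * C := by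
    rw [h0, hN _ hNk]
    obtain ⟨u₀, rfl⟩ := hu
    obtain ⟨v₀, rfl⟩ := hv
    have e1 := hμ.idem a b u₀
    have e2 := hμ.idem a b v₀
    generalize μ a b u₀ = u at *
    generalize μ a b v₀ = v at *
    have e3 := dist_triangle (μ a b u) u p
    have e4 := dist_triangle p v (μ a b v)
    have e5 := dist_triangle4 u (μ a b u) (μ a b v) v
    rw [dist_comm u (μ a b u)] at e5
    rw [dist_comm v (μ a b v)] at e4
    simp only [excess]
    linarith
  linarith

/-- Points close to geodesics from `a` to `b` are uniformly close to the coarse interval. -/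
lemma CoarseMedianIdentities.exists_near_interval {μ : X → X → X → X} {C δ : ℝ}
    (hμ : CoarseMedianIdentities μ C) (hδ0 : 0 ≤ δ) (hδ : FourPoint X δ)
    (hgeo : HasIntegerGeodesics X) {κ : ℝ} (hκ : 0 ≤ κ) :
    ∃ E : ℝ, 0 ≤ E ∧ ∀ a b p : X, excess a b p ≤ κ → ∃ x, dist p (μ a b x) ≤ E := by
  obtain ⟨K, hK, himp⟩ := hμ.improve_bound hδ0 hδ hgeo hκ
  refine ⟨2 + 2 * K, by positivity, fun a b p hp => ?_⟩
  -- Some bound depending on `a` and `b` is available. Improving a bound within one of the infimum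
  -- gives `inf ≤ (inf + 1) / 2 + K`, so `inf ≤ 1 + 2 K` uniformly.
  set S : Set ℝ := {D | 0 ≤ D ∧ ∀ p, excess a b p ≤ κ → ∃ u ∈ range (μ a b), dist p u ≤ D}
  have hbdd : BddBelow S := ⟨0, fun D hD => hD.1⟩
  have hne : S.Nonempty := by
    refine ⟨dist a b + κ + C, by have := hμ.nonneg; positivity, fun p hp =>
      ⟨μ a b a, mem_range_self a, ?_⟩⟩
    have h1 := dist_triangle p a (μ a b a)
    have h2 := hμ.left a b
    have h3 := dist_nonneg (x := p) (y := b)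
    rw [dist_comm] at h2
    simp only [excess] at hp
    rw [dist_comm p a] at h1
    linarith
  obtain ⟨D, hD, hlt⟩ := exists_lt_of_csInf_lt hne (lt_add_one (sInf S))
  have h1 : sInf S ≤ D / 2 + K :=
    csInf_le hbdd ⟨by have := hD.1; positivity, himp a b D hD.1 hD.2⟩
  obtain ⟨_, ⟨x, rfl⟩, hx⟩ := hD.2 p hp
  exact ⟨x, by linarith⟩

/-- In a hyperbolic space, coarse medians of three points are close to geodesics between the
points. -/
theorem CoarseMedianIdentities.exists_excess_le {μ : X → X → X → X} {C δ : ℝ}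
    (hμ : CoarseMedianIdentities μ C) (hδ0 : 0 ≤ δ) (hδ : FourPoint X δ)
    (hgeo : HasIntegerGeodesics X) : ∃ K : ℝ, ∀ a b c : X, excess a b (μ a b c) ≤ K := by
  obtain ⟨E, hE, hnear⟩ := hμ.exists_near_interval hδ0 hδ hgeo hδ0
  refine ⟨2 * (2 * C + C * (1 + 2 * E) + E) + 2, fun a b c => ?_⟩
  set m := μ a b c with hm
  obtain ⟨N, γ, h0, hN, hγ, -⟩ := hgeo m a
  have hmN : dist m a = N := by
    have := (hγ N le_rfl).1
    rwa [hN N le_rfl] at this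
  -- Up to rounding, `t` is the Gromov product of `a` and `b` at `m`, so `p` is the branch point of
  -- the tripod: it is near geodesics from `m` to `a` and from `m` to `b`.
  obtain ⟨t, ht⟩ : ∃ t, t = ⌊excess a b m / 2⌋₊ := ⟨_, rfl⟩
  have hex := excess_nonneg a b m
  have ht1 : (t : ℝ) ≤ excess a b m / 2 := by rw [ht]; exact Nat.floor_le (by positivity)
  have ht2 : excess a b m / 2 < t + 1 := by rw [ht]; exact Nat.lt_floor_add_one _
  have htN : t ≤ N := by
    have : (t : ℝ) ≤ N := by
      have := dist_triangle m a b
      rw [← hmN]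
      simp only [excess] at ht1
      rw [dist_comm a m] at ht1
      linarith
    exact_mod_cast this
  obtain ⟨h1, h2⟩ := hγ t htN
  set p := γ t
  obtain ⟨x, hx⟩ := hnear a m p (by
    simp only [excess]
    rw [dist_comm a p, dist_comm p m, dist_comm a m, h1, h2, hmN]
    linarith)
  obtain ⟨y, hy⟩ := hnear m b p (by
    have h3 := hδ p b m a
    simp only [excess] at *
    rw [h1]
    rw [dist_comm p m, h1, h2, hmN, dist_comm b a, dist_comm b m] at h3
    rw [dist_comm a m, hmN] at ht1
    rcases max_cases ((t : ℝ) + dist a b) (N - t + dist m b) with ⟨e, -⟩ | ⟨e, -⟩ <;>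
      rw [e] at h3 <;> linarith)
  -- Now `m ≈ μ s m s' ≈ μ s m s ≈ s ≈ p`, which bounds `t`.
  have h4 := hμ.nested a b c x y
  rw [← hm] at h4
  set s := μ a m x
  set s' := μ m b y
  have h5 := hμ.lipschitz s s m m s' s
  have h6 := hμ.left s m
  have h7 : dist s' s ≤ 2 * E := by
    have := dist_triangle_left s' s p
    linarith
  have h8 : C * (1 + dist s s + dist m m + dist s' s) ≤ C * (1 + 2 * E) := by
    refine mul_le_mul_of_nonneg_left ?_ hμ.nonneg
    rw [dist_self, dist_self]; linarith
  have h9 := dist_triangle4 m (μ s m s') (μ s m s) s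
  have h10 := dist_triangle_right m p s
  rw [h1] at h10
  linarith

end Hyperbolic

lemma SimpleGraph.Connected.exists_geodesic {V : Type*} {G : SimpleGraph V} (hG : G.Connected)
    (x y : V) : ∃ (N : ℕ) (γ : ℕ → V), γ 0 = x ∧ (∀ i, N ≤ i → γ i = y) ∧
      (∀ i ≤ N, G.dist x (γ i) = i ∧ G.dist (γ i) y = N - i) ∧
      ∀ i, G.dist (γ i) (γ (i + 1)) ≤ 1 := by
  obtain ⟨w, hw⟩ := hG.exists_walk_length_eq_dist x y
  refine ⟨w.length, w.getVert, w.getVert_zero, fun i h => w.getVert_of_length_le h,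
    fun i hi => ?_, fun i => ?_⟩
  · have h1 : G.dist x (w.getVert i) ≤ i :=
      (SimpleGraph.dist_le (w.take i)).trans (by rw [SimpleGraph.Walk.take_length]; omega)
    have h2 : G.dist (w.getVert i) y ≤ w.length - i :=
      (SimpleGraph.dist_le (w.drop i)).trans (by rw [SimpleGraph.Walk.drop_length])
    have h3 : G.dist x y ≤ G.dist x (w.getVert i) + G.dist (w.getVert i) y := hG.dist_triangle
    omega
  · rcases lt_or_ge i w.length with h | h
    · exact (SimpleGraph.dist_eq_one_iff_adj.mpr (w.adj_getVert_succ h)).le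
    · rw [w.getVert_of_length_le h, w.getVert_of_length_le (by omega), SimpleGraph.dist_self]
      exact zero_le_one

lemma hasIntegerGeodesics_vertexSpace {V : Type*} (G : SimpleGraph V) (hG : G.Connected) :
    HasIntegerGeodesics (VertexSpace G hG) := by
  intro x y
  obtain ⟨N, γ, h0, hN, hγ, hstep⟩ := hG.exists_geodesic x y
  refine ⟨N, γ, h0, hN, fun i hi => ⟨?_, ?_⟩, fun i => ?_⟩
  · exact congrArg (Nat.cast (R := ℝ)) (hγ i hi).1
  · exact (congrArg (Nat.cast (R := ℝ)) (hγ i hi).2).trans (Nat.cast_sub hi)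
  · exact (Nat.cast_le (α := ℝ).mpr (hstep i)).trans_eq Nat.cast_one

/-! ### Distances in the hyperbolic cone -/

namespace HyperbolicCone

variable {Z : Type*} [PseudoMetricSpace Z] {r : ℝ} {H : HyperbolicCone Z r}

/-- The scale at which radial geodesics to `v` and to `w` separate. -/
noncomputable def scale (v w : H.Vertex) : ℝ := dist (v.2 : Z) w.2 + r ^ v.1 + r ^ w.1

lemma scale_comm (v w : H.Vertex) : scale v w = scale w v := by
  rw [scale, scale, dist_comm]; ring

lemma pow_le_scale_left (v w : H.Vertex) : r ^ v.1 ≤ scale v w := by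
  have := dist_nonneg (x := (v.2 : Z)) (y := w.2)
  have := pow_pos H.pos w.1
  rw [scale]; linarith

lemma pow_le_scale_right (v w : H.Vertex) : r ^ w.1 ≤ scale v w := by
  rw [scale_comm]; exact pow_le_scale_left w v

lemma scale_pos (v w : H.Vertex) : 0 < scale v w :=
  (pow_pos H.pos v.1).trans_le (pow_le_scale_left v w)

lemma scale_triangle (v u w : H.Vertex) : scale v w ≤ scale v u + scale u w := by
  have := dist_triangle (v.2 : Z) u.2 w.2
  have := pow_pos H.pos u.1
  simp only [scale]; linarith

/-- Let the smallest of the four mixed scales be, say, `scale x z`. The triangle inequality bounds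
`scale x y` and `scale z w` by twice `scale y z` and `scale x w`. -/
lemma scale_mul_scale_le (x y z w : H.Vertex) :
    scale x y * scale z w ≤ 4 * (scale x z * scale y w) ∨
      scale x y * scale z w ≤ 4 * (scale x w * scale y z) := by
  have t1 := scale_triangle x z y
  have t2 := scale_triangle z x w
  have t3 := scale_triangle x w y
  have t4 := scale_triangle z y w
  rw [scale_comm z x] at t2
  rw [scale_comm w y] at t3
  rw [scale_comm z y] at t1 t4
  have p1 := scale_pos x y
  have p2 := scale_pos z w
  rcases le_total (min (scale x z) (scale y w)) (min (scale x w) (scale y z)) with h | h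
  · right
    rcases le_total (scale x z) (scale y w) with h' | h'
    · rw [min_eq_left h'] at h
      have h1 := h.trans (min_le_left _ _)
      have h2 := h.trans (min_le_right _ _)
      nlinarith [mul_le_mul (show scale x y ≤ 2 * scale y z by linarith)
        (show scale z w ≤ 2 * scale x w by linarith) p2.le (by linarith)]
    · rw [min_eq_right h'] at h
      have h1 := h.trans (min_le_left _ _)
      have h2 := h.trans (min_le_right _ _)
      nlinarith [mul_le_mul (show scale x y ≤ 2 * scale x w by linarith)
        (show scale z w ≤ 2 * scale y z by linarith) p2.le (by linarith)]
  · left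
    rcases le_total (scale x w) (scale y z) with h' | h'
    · rw [min_eq_left h'] at h
      have h1 := h.trans (min_le_left _ _)
      have h2 := h.trans (min_le_right _ _)
      nlinarith [mul_le_mul (show scale x y ≤ 2 * scale y w by linarith)
        (show scale z w ≤ 2 * scale x z by linarith) p2.le (by linarith)]
    · rw [min_eq_right h'] at h
      have h1 := h.trans (min_le_left _ _)
      have h2 := h.trans (min_le_right _ _)
      nlinarith [mul_le_mul (show scale x y ≤ 2 * scale x z by linarith)
        (show scale z w ≤ 2 * scale y w by linarith) p2.le (by linarith)]

lemma dist_le_of_adj {v w : H.Vertex} (h : H.graph.Adj v w) :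
    v.1 ≤ w.1 + 1 ∧ w.1 ≤ v.1 + 1 ∧ dist (v.2 : Z) w.2 ≤ 4 * r ^ min v.1 w.1 := by
  have hrel : ∀ v w : H.Vertex, ((v.1 = w.1 ∧ (v.closedBall ∩ w.closedBall).Nonempty) ∨
      (v.1 + 1 = w.1 ∧ w.ball ⊆ v.ball)) →
      v.1 ≤ w.1 + 1 ∧ w.1 ≤ v.1 + 1 ∧ dist (v.2 : Z) w.2 ≤ 4 * r ^ min v.1 w.1 := by
    rintro v w (⟨h1, x, hx, hy⟩ | ⟨h1, h2⟩)
    · refine ⟨by omega, by omega, ?_⟩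
      simp only [Vertex.closedBall, Metric.mem_closedBall] at hx hy
      have := dist_triangle_left (v.2 : Z) w.2 x
      have e : r ^ w.1 = r ^ v.1 := by rw [h1]
      rw [min_eq_left h1.le]
      linarith
    · refine ⟨by omega, by omega, ?_⟩
      have h3 : (w.2 : Z) ∈ v.ball := h2 (Metric.mem_ball_self (mul_pos two_pos (pow_pos H.pos _)))
      rw [Vertex.ball, Metric.mem_ball, dist_comm] at h3
      rw [min_eq_left (by omega)]
      have := pow_pos H.pos v.1
      linarith
  rw [graph, SimpleGraph.fromRel_adj] at h
  rcases h with ⟨-, h | h⟩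
  · exact hrel v w h
  · obtain ⟨h1, h2, h3⟩ := hrel w v h
    exact ⟨h2, h1, by rwa [dist_comm, min_comm]⟩

/-- With `i` edges left the walk has level at least `v.1 - i`, so the displacements form a geometric
series. The factor `r ^ p.length` avoids negative exponents. -/
lemma dist_mul_pow_length_le {u v : H.Vertex} (p : H.graph.Walk u v) :
    dist (u.2 : Z) v.2 * r ^ p.length ≤ 8 * r ^ v.1 ∧ v.1 ≤ u.1 + p.length := by
  have hr := H.pos
  have hr6 := H.le
  induction p with
  | nil => 
    simp only [dist_self, zero_mul, SimpleGraph.Walk.length_nil]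
    exact ⟨by positivity, le_rfl⟩
  | @cons u s v h p ih =>
    obtain ⟨h1, h2, h3⟩ := dist_le_of_adj h
    obtain ⟨h4, h5⟩ := ih
    rw [SimpleGraph.Walk.length_cons]
    refine ⟨?_, by omega⟩
    have hp : 0 < r ^ (p.length + 1) := pow_pos hr _
    have hv : 0 < r ^ v.1 := pow_pos hr _
    have e1 := mul_le_mul_of_nonneg_right (dist_triangle (u.2 : Z) s.2 v.2) hp.le
    have e2 := mul_le_mul_of_nonneg_right h3 hp.le
    have e3 : r ^ min u.1 s.1 * r ^ (p.length + 1) ≤ r ^ v.1 := by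
      rw [← pow_add]
      exact pow_le_pow_of_le_one hr.le (by linarith) (by omega)
    have e4 : dist (s.2 : Z) v.2 * r ^ (p.length + 1) ≤ 8 * r ^ v.1 * (1 / 6) := by
      rw [pow_succ, ← mul_assoc]
      exact mul_le_mul h4 hr6 hr.le (by positivity)
    linarith

lemma dist_mul_pow_dist_le (hc : H.graph.Connected) (u v : H.Vertex) :
    dist (u.2 : Z) v.2 * r ^ H.graph.dist u v ≤ 8 * r ^ v.1 ∧
      v.1 ≤ u.1 + H.graph.dist u v := by
  obtain ⟨p, hp⟩ := hc.exists_walk_length_eq_dist u v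
  rw [← hp]
  exact dist_mul_pow_length_le p

/-- The lower bound for distances in the cone. -/
lemma scale_sq_mul_pow_le (hc : H.graph.Connected) (v w : H.Vertex) :
    scale v w ^ 2 * r ^ (H.graph.dist v w + 1) ≤ 520 * r ^ (v.1 + w.1) := by
  have hr := H.pos
  have hr1 : r ≤ 1 := by have := H.le; linarith
  obtain ⟨N, γ, h0, hN, hγ, -⟩ := hc.exists_geodesic v w
  have hvw : H.graph.dist v w = N := by
    have := (hγ N le_rfl).1
    rwa [hN N le_rfl] at this
  have hk := (dist_mul_pow_dist_le hc v w).2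
  have hl := (dist_mul_pow_dist_le hc w v).2
  rw [SimpleGraph.dist_comm] at hl
  rw [hvw] at hk hl ⊢
  -- Split where the lowest levels reachable from both ends balance, `v.1 - t ≈ w.1 - (N - t)`; `e`
  -- below is the parity error.
  obtain ⟨t, ht⟩ : ∃ t, t = (N + v.1 - w.1) / 2 := ⟨_, rfl⟩
  obtain ⟨h1, h2⟩ := hγ t (by omega)
  set u := γ t
  have ha := (dist_mul_pow_dist_le hc u v).1
  have hb := (dist_mul_pow_dist_le hc u w).1
  rw [SimpleGraph.dist_comm, h1] at ha
  rw [h2] at hb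
  have htri := dist_triangle_left (v.2 : Z) w.2 u.2
  obtain ⟨e, he, he1⟩ : ∃ e, N + v.1 = 2 * t + w.1 + e ∧ e ≤ 1 :=
    ⟨N + v.1 - w.1 - 2 * t, by omega, by omega⟩
  have ha0 := dist_nonneg (x := (u.2 : Z)) (y := v.2)
  have hb0 := dist_nonneg (x := (u.2 : Z)) (y := w.2)
  generalize hA : dist (u.2 : Z) v.2 = a at *
  generalize hB : dist (u.2 : Z) w.2 = b at *
  have pv := pow_pos hr v.1
  have pw := pow_pos hr w.1
  have hA2 : a ^ 2 * r ^ (N + 1) ≤ 64 * r ^ (v.1 + w.1) := by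
    refine le_of_mul_le_mul_right ?_ pv
    calc a ^ 2 * r ^ (N + 1) * r ^ v.1 = (a * r ^ t) ^ 2 * r ^ (w.1 + e + 1) := by
          rw [mul_pow, ← pow_mul, mul_assoc, mul_assoc, ← pow_add, ← pow_add]
          congr 2; omega
      _ ≤ (8 * r ^ v.1) ^ 2 * r ^ w.1 := by
          refine mul_le_mul (pow_le_pow_left₀ (by positivity) ha 2)
            (pow_le_pow_of_le_one hr.le hr1 (by omega)) (by positivity) (by positivity)
      _ = 64 * r ^ (v.1 + w.1) * r ^ v.1 := by rw [pow_add]; ring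
  have hB2 : b ^ 2 * r ^ (N + 1) ≤ 64 * r ^ (v.1 + w.1) := by
    refine le_of_mul_le_mul_right ?_ pw
    calc b ^ 2 * r ^ (N + 1) * r ^ w.1 = (b * r ^ (N - t)) ^ 2 * r ^ (v.1 + (1 - e)) := by
          rw [mul_pow, ← pow_mul, mul_assoc, mul_assoc, ← pow_add, ← pow_add]
          congr 2; omega
      _ ≤ (8 * r ^ w.1) ^ 2 * r ^ v.1 := by
          refine mul_le_mul (pow_le_pow_left₀ (by positivity) hb 2)
            (pow_le_pow_of_le_one hr.le hr1 (by omega)) (by positivity) (by positivity)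
      _ = 64 * r ^ (v.1 + w.1) * r ^ w.1 := by rw [pow_add]; ring
  have hV2 : (r ^ v.1) ^ 2 * r ^ (N + 1) ≤ r ^ (v.1 + w.1) := by
    rw [← pow_mul, ← pow_add]
    exact pow_le_pow_of_le_one hr.le hr1 (by omega)
  have hW2 : (r ^ w.1) ^ 2 * r ^ (N + 1) ≤ r ^ (v.1 + w.1) := by
    rw [← pow_mul, ← pow_add]
    exact pow_le_pow_of_le_one hr.le hr1 (by omega)
  -- Hence `520 = 4 * (64 + 64 + 1 + 1)`.
  have hsq : scale v w ^ 2 ≤ 4 * (a ^ 2 + b ^ 2 + (r ^ v.1) ^ 2 + (r ^ w.1) ^ 2) := by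
    have hle : scale v w ≤ a + b + r ^ v.1 + r ^ w.1 := by rw [scale]; linarith
    refine (pow_le_pow_left₀ (scale_pos v w).le hle 2).trans ?_
    nlinarith [sq_nonneg (a - b), sq_nonneg (a - r ^ v.1), sq_nonneg (a - r ^ w.1),
      sq_nonneg (b - r ^ v.1), sq_nonneg (b - r ^ w.1), sq_nonneg (r ^ v.1 - r ^ w.1)]
  have := mul_le_mul_of_nonneg_right hsq (pow_pos hr (N + 1)).le
  linarith

lemma exists_parent (v : H.Vertex) {k : ℕ} (hv : v.1 = k + 1) :
    ∃ s : H.Vertex, s.1 = k ∧ dist (v.2 : Z) s.2 < r ^ k ∧ H.graph.Adj v s := by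
  obtain ⟨s, hs, hd⟩ := H.exists_near k v.2
  refine ⟨⟨k, s, hs⟩, rfl, hd, ?_⟩
  rw [graph, SimpleGraph.fromRel_adj]
  refine ⟨fun h => ?_, .inr (.inr ⟨hv.symm, fun x hx => ?_⟩)⟩
  · have := congrArg Sigma.fst h
    simp only at this
    omega
  · simp only [Vertex.ball, Metric.mem_ball] at hx ⊢
    have e : r ^ v.1 = r ^ (k + 1) := by rw [hv]
    have h1 := dist_triangle x v.2 s
    have hk := pow_pos H.pos k
    have h2 : r ^ (k + 1) ≤ r ^ k * (1 / 6) := by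
      rw [pow_succ]; exact mul_le_mul_of_nonneg_left H.le hk.le
    linarith

/-- Follow parents; `6 / 5 = 1 / (1 - 1 / 6)` sums the displacements. -/
lemma exists_radial_ancestor (hc : H.graph.Connected) (i k : ℕ) (hik : i ≤ k) :
    ∀ v : H.Vertex, v.1 = k → ∃ u : H.Vertex, u.1 = i ∧ H.graph.dist v u ≤ k - i ∧
      dist (v.2 : Z) u.2 ≤ 6 / 5 * (r ^ i - r ^ k) := by
  induction k, hik using Nat.le_induction with
  | base => exact fun v hv => ⟨v, hv, by simp, by simp⟩
  | succ k hik ih =>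
    intro v hv
    obtain ⟨s, hs, hd, hadj⟩ := exists_parent v hv
    obtain ⟨u, hu, h1, h2⟩ := ih s hs
    refine ⟨u, hu, ?_, ?_⟩
    · have h3 : H.graph.dist v u ≤ H.graph.dist v s + H.graph.dist s u := hc.dist_triangle
      rw [SimpleGraph.dist_eq_one_iff_adj.mpr hadj] at h3
      omega
    · have h3 := dist_triangle (v.2 : Z) s.2 u.2
      have hk := pow_pos H.pos k
      have h4 : r ^ (k + 1) ≤ r ^ k * (1 / 6) := by
        rw [pow_succ]; exact mul_le_mul_of_nonneg_left H.le hk.le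
      linarith

/-- Radial paths from `v` and `w` up to level `i` end at vertices whose closed balls both contain
the centre of `v`, since `6 / 5 + 4 / 5 = 2`; at most one horizontal edge remains. -/
lemma graph_dist_le [BoundedSpace Z] (hZ : Metric.diam (univ : Set Z) < 1)
    (hc : H.graph.Connected) {v w : H.Vertex} {i : ℕ} (hv : i ≤ v.1) (hw : i ≤ w.1)
    (h : i = 0 ∨ scale v w ≤ 4 / 5 * r ^ i) : H.graph.dist v w ≤ (v.1 - i) + (w.1 - i) + 1 := by
  obtain ⟨u, hu, h1, h2⟩ := exists_radial_ancestor hc i v.1 hv v rfl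
  obtain ⟨u', hu', h3, h4⟩ := exists_radial_ancestor hc i w.1 hw w rfl
  have hpi := pow_pos H.pos i
  have hpv := pow_pos H.pos v.1
  have hpw := pow_pos H.pos w.1
  have h5 : dist (v.2 : Z) u'.2 ≤ 2 * r ^ i := by
    rcases h with rfl | h
    · have := Metric.dist_le_diam_of_mem (Bornology.IsBounded.all (univ : Set Z))
        (mem_univ (v.2 : Z)) (mem_univ (u'.2 : Z))
      rw [pow_zero]; linarith
    · have := dist_triangle (v.2 : Z) w.2 u'.2
      rw [scale] at h
      linarith
  have h6 : H.graph.dist u u' ≤ 1 := by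
    by_cases he : u = u'
    · rw [he, SimpleGraph.dist_self]; exact zero_le_one
    · refine (SimpleGraph.dist_eq_one_iff_adj.mpr ?_).le
      rw [graph, SimpleGraph.fromRel_adj]
      refine ⟨he, .inl (.inl ⟨hu.trans hu'.symm, v.2, ?_, ?_⟩)⟩
      · have e : r ^ u.1 = r ^ i := by rw [hu]
        rw [Vertex.closedBall, Metric.mem_closedBall]; linarith
      · have e : r ^ u'.1 = r ^ i := by rw [hu']
        rw [Vertex.closedBall, Metric.mem_closedBall]; linarith
  have h7 : H.graph.dist v w ≤ H.graph.dist v u + H.graph.dist u w := hc.dist_triangle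
  have h8 : H.graph.dist u w ≤ H.graph.dist u u' + H.graph.dist u' w := hc.dist_triangle
  rw [SimpleGraph.dist_comm (u := u') (v := w)] at h8
  omega

/-- The upper bound for distances in the cone. -/
lemma pow_le_scale_sq_mul_pow [BoundedSpace Z] (hZ : Metric.diam (univ : Set Z) < 1)
    (hc : H.graph.Connected) (v w : H.Vertex) :
    r ^ (v.1 + w.1 + 3) ≤ 2 * scale v w ^ 2 * r ^ H.graph.dist v w := by
  classical
  have hr := H.pos
  have hr1 : r ≤ 1 := by have := H.le; linarith
  let P : ℕ → Prop := fun i => i = 0 ∨ scale v w ≤ 4 / 5 * r ^ i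
  -- The level `i` is the deepest at which the radial paths are still known to be adjacent;
  -- maximality bounds the scale from below.
  obtain ⟨i, hi⟩ : ∃ i, i = Nat.findGreatest P (min v.1 w.1) := ⟨_, rfl⟩
  have hPi : P i := by
    rw [hi]; exact Nat.findGreatest_spec (P := P) (Nat.zero_le _) (Or.inl rfl)
  have hle : i ≤ min v.1 w.1 := by rw [hi]; exact Nat.findGreatest_le _
  have hnext : 4 / 5 * r ^ (i + 1) ≤ scale v w := by
    rcases hle.eq_or_lt with he | hlt
    · have h1 : r ^ i ≤ scale v w := by
        rcases min_choice v.1 w.1 with h | h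
        · rw [he, h]; exact pow_le_scale_left v w
        · rw [he, h]; exact pow_le_scale_right v w
      have h2 : r ^ (i + 1) ≤ r ^ i := pow_le_pow_of_le_one hr.le hr1 (by omega)
      have := pow_pos hr (i + 1)
      linarith
    · have := Nat.findGreatest_is_greatest (P := P) (n := min v.1 w.1) (k := i + 1)
        (by omega) hlt
      simp only [P, not_or, not_le] at this
      exact this.2.le
  have hN := graph_dist_le hZ hc (hle.trans (min_le_left _ _)) (hle.trans (min_le_right _ _)) hPi
  have hiv := hle.trans (min_le_left _ _)
  have hiw := hle.trans (min_le_right _ _)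
  have hp := pow_pos hr (i + 1)
  have h1 : r ^ (2 * (i + 1)) ≤ 2 * scale v w ^ 2 := by
    rw [mul_comm 2, pow_mul]
    have := pow_le_pow_left₀ (by positivity) hnext 2
    nlinarith
  calc r ^ (v.1 + w.1 + 3) = r ^ (2 * (i + 1)) * r ^ ((v.1 - i) + (w.1 - i) + 1) := by
        rw [← pow_add]; congr 1; omega
    _ ≤ 2 * scale v w ^ 2 * r ^ H.graph.dist v w :=
        mul_le_mul h1 (pow_le_pow_of_le_one hr.le hr1 hN) (by positivity) (by positivity)

/-- Logarithms to base `r` of the distance estimates. The `8` collects the exponents `3 + 3 + 2`,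
and `e` absorbs the multiplicative constant. -/
lemma exists_add_dist_le [BoundedSpace Z] (hZ : Metric.diam (univ : Set Z) < 1)
    (hc : H.graph.Connected) : ∃ e : ℕ, ∀ x y z w : H.Vertex,
      scale x y * scale z w ≤ 4 * (scale x z * scale y w) →
      H.graph.dist x y + H.graph.dist z w ≤ H.graph.dist x z + H.graph.dist y w + e := by
  have hr := H.pos
  have hr1 : r < 1 := by have := H.le; linarith
  obtain ⟨e, he⟩ := exists_pow_lt_of_lt_one (show (0 : ℝ) < 1 / (64 * 520 ^ 2) by norm_num) hr1
  refine ⟨8 + e, fun x y z w h => ?_⟩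
  have u1 := pow_le_scale_sq_mul_pow hZ hc x y
  have u2 := pow_le_scale_sq_mul_pow hZ hc z w
  have l1 := scale_sq_mul_pow_le hc x z
  have l2 := scale_sq_mul_pow_le hc y w
  have p1 := scale_pos x y
  have p2 := scale_pos z w
  have p3 := scale_pos x z
  have p4 := scale_pos y w
  generalize H.graph.dist x y = a at *
  generalize H.graph.dist z w = b at *
  generalize H.graph.dist x z = c at *
  generalize H.graph.dist y w = d at *
  generalize scale x y = s1 at *
  generalize scale z w = s2 at *
  generalize scale x z = s3 at *
  generalize scale y w = s4 at *
  have q1 := mul_le_mul u1 u2 (by positivity) (by positivity)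
  have q2 := mul_le_mul l1 l2 (by positivity) (by positivity)
  have q3 := pow_le_pow_left₀ (by positivity) h 2
  set P := r ^ (x.1 + y.1 + z.1 + w.1) with hP
  have hPpos : 0 < P := pow_pos hr _
  have main : r ^ (c + d + 8) ≤ 64 * 520 ^ 2 * r ^ (a + b) := by
    refine le_of_mul_le_mul_left ?_ hPpos
    calc P * r ^ (c + d + 8) = r ^ (x.1 + y.1 + 3) * r ^ (z.1 + w.1 + 3) * r ^ (c + d + 2) := by
          rw [hP]; ring
      _ ≤ (2 * s1 ^ 2 * r ^ a * (2 * s2 ^ 2 * r ^ b)) * r ^ (c + d + 2) :=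
          mul_le_mul_of_nonneg_right q1 (by positivity)
      _ = 4 * (s1 * s2) ^ 2 * (r ^ (a + b) * r ^ (c + d + 2)) := by ring
      _ ≤ 4 * (4 * (s3 * s4)) ^ 2 * (r ^ (a + b) * r ^ (c + d + 2)) :=
          mul_le_mul_of_nonneg_right (by linarith) (by positivity)
      _ = 64 * (s3 ^ 2 * r ^ (c + 1) * (s4 ^ 2 * r ^ (d + 1))) * r ^ (a + b) := by ring
      _ ≤ 64 * (520 * r ^ (x.1 + z.1) * (520 * r ^ (y.1 + w.1))) * r ^ (a + b) :=
          mul_le_mul_of_nonneg_right (by linarith) (by positivity)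
      _ = P * (64 * 520 ^ 2 * r ^ (a + b)) := by rw [hP]; ring
  have hlt : r ^ (c + d + (8 + e)) < r ^ (a + b) := by
    have h1 := mul_le_mul_of_nonneg_right main (pow_pos hr e).le
    have h2 := mul_lt_mul_of_pos_left he (pow_pos hr (a + b))
    have h3 : r ^ (c + d + (8 + e)) = r ^ (c + d + 8) * r ^ e := by ring
    rw [h3]
    linarith
  exact ((pow_lt_pow_iff_right_of_lt_one₀ hr hr1).mp hlt).le

/-- The hyperbolic cone is hyperbolic. -/
theorem exists_fourPoint [BoundedSpace Z] (hZ : Metric.diam (univ : Set Z) < 1)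
    (hc : H.graph.Connected) : ∃ δ : ℝ, 0 ≤ δ ∧ FourPoint (VertexSpace H.graph hc) δ := by
  obtain ⟨e, he⟩ := exists_add_dist_le hZ hc
  refine ⟨e, Nat.cast_nonneg e, fun x y z w => ?_⟩
  change ((H.graph.dist x y : ℕ) : ℝ) + (H.graph.dist z w : ℕ) ≤
    max (((H.graph.dist x z : ℕ) : ℝ) + (H.graph.dist y w : ℕ))
      (((H.graph.dist x w : ℕ) : ℝ) + (H.graph.dist y z : ℕ)) + (e : ℕ)
  rcases scale_mul_scale_le (x : H.Vertex) y z w with h | h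
  · have h1 : ((H.graph.dist x y : ℕ) : ℝ) + (H.graph.dist z w : ℕ) ≤
        (H.graph.dist x z : ℕ) + (H.graph.dist y w : ℕ) + (e : ℕ) := by
      exact_mod_cast he x y z w h
    exact h1.trans (add_le_add_left (le_max_left _ _) _)
  · have h1 : ((H.graph.dist x y : ℕ) : ℝ) + (H.graph.dist z w : ℕ) ≤
        (H.graph.dist x w : ℕ) + (H.graph.dist y z : ℕ) + (e : ℕ) := by
      have h2 := he x y w z (by rwa [scale_comm (H := H) w z])
      have h3 : H.graph.dist (w : H.Vertex) z = H.graph.dist z w := SimpleGraph.dist_comm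
      exact_mod_cast h3 ▸ h2
    exact h1.trans (add_le_add_left (le_max_right _ _) _)

/-- A vertex that is close to a geodesic from `v` to `w` lies close to the radial geodesic to
one of them, and not far above their branch point. -/
theorem exists_scale_le [BoundedSpace Z] (hZ : Metric.diam (univ : Set Z) < 1)
    (hc : H.graph.Connected) (K : ℕ) : ∃ M : ℝ, 1 ≤ M ∧ ∀ v w m : H.Vertex,
      H.graph.dist v m + H.graph.dist m w ≤ H.graph.dist v w + K →
      (scale v m ≤ M * r ^ m.1 ∨ scale w m ≤ M * r ^ m.1) ∧ r ^ m.1 ≤ M * scale v w := by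
  have hr := H.pos
  have hr1 : r ≤ 1 := by have := H.le; linarith
  -- Two lower bounds contribute `520` each, the upper bound contributes `2`, and the exponents add
  -- up to `K + 2 + 3`.
  obtain ⟨M, hM⟩ : ∃ M, M = 2 * 520 ^ 2 / r ^ (K + 5) := ⟨_, rfl⟩
  have hM1 : 1 ≤ M := by
    rw [hM, one_le_div (pow_pos hr _)]
    have : r ^ (K + 5) ≤ 1 := pow_le_one₀ hr.le hr1
    linarith
  refine ⟨2 * M, by linarith, fun v w m h => ?_⟩
  have l1 := scale_sq_mul_pow_le hc v m
  have l2 := scale_sq_mul_pow_le hc m w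
  have u1 := pow_le_scale_sq_mul_pow hZ hc v w
  have p1 := scale_pos v m
  have p2 := scale_pos m w
  have p3 := scale_pos v w
  have t := scale_triangle v m w
  have g1 := pow_le_scale_right v m
  have g2 := pow_le_scale_left m w
  have pm := pow_pos hr m.1
  rw [scale_comm w m]
  generalize H.graph.dist v m = a at *
  generalize H.graph.dist m w = b at *
  generalize H.graph.dist v w = c at *
  generalize scale v m = s1 at *
  generalize scale m w = s2 at *
  generalize scale v w = s3 at *
  have hprod : s1 * s2 ≤ M * (r ^ m.1 * s3) := by
    have q := mul_le_mul l1 l2 (by positivity) (by positivity)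
    have hpow : r ^ (c + K + 5) ≤ r ^ (a + 1) * r ^ (b + 1) * r ^ 3 := by
      rw [← pow_add, ← pow_add]
      exact pow_le_pow_of_le_one hr.le hr1 (by omega)
    have main : (s1 * s2) ^ 2 * r ^ (K + 5) ≤ 2 * 520 ^ 2 * (r ^ m.1 * s3) ^ 2 := by
      refine le_of_mul_le_mul_right ?_ (pow_pos hr c)
      calc (s1 * s2) ^ 2 * r ^ (K + 5) * r ^ c = (s1 * s2) ^ 2 * r ^ (c + K + 5) := by ring
        _ ≤ (s1 * s2) ^ 2 * (r ^ (a + 1) * r ^ (b + 1) * r ^ 3) :=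
            mul_le_mul_of_nonneg_left hpow (by positivity)
        _ = s1 ^ 2 * r ^ (a + 1) * (s2 ^ 2 * r ^ (b + 1)) * r ^ 3 := by ring
        _ ≤ 520 * r ^ (v.1 + m.1) * (520 * r ^ (m.1 + w.1)) * r ^ 3 :=
            mul_le_mul_of_nonneg_right q (by positivity)
        _ = 520 ^ 2 * (r ^ m.1) ^ 2 * r ^ (v.1 + w.1 + 3) := by ring
        _ ≤ 520 ^ 2 * (r ^ m.1) ^ 2 * (2 * s3 ^ 2 * r ^ c) :=
            mul_le_mul_of_nonneg_left u1 (by positivity)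
        _ = 2 * 520 ^ 2 * (r ^ m.1 * s3) ^ 2 * r ^ c := by ring
    have main' : (s1 * s2) ^ 2 ≤ M * (r ^ m.1 * s3) ^ 2 := by
      rw [hM, div_mul_eq_mul_div, le_div_iff₀ (pow_pos hr _)]
      exact main
    refine le_of_sq_le_sq ?_ (by positivity)
    rw [mul_pow M]
    refine main'.trans (mul_le_mul_of_nonneg_right ?_ (by positivity))
    nlinarith
  refine ⟨?_, ?_⟩
  -- Since `s3 ≤ s1 + s2`, the larger scale is at least `s3 / 2`; cancel it in `hprod`.
  · rcases le_total s1 s2 with hle | hle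
    · left
      refine le_of_mul_le_mul_right ?_ p2
      have h2 : M * r ^ m.1 * s3 ≤ M * r ^ m.1 * (2 * s2) :=
        mul_le_mul_of_nonneg_left (by linarith) (by positivity)
      linarith
    · right
      refine le_of_mul_le_mul_right ?_ p1
      have h2 : M * r ^ m.1 * s3 ≤ M * r ^ m.1 * (2 * s1) :=
        mul_le_mul_of_nonneg_left (by linarith) (by positivity)
      linarith
  · have h1 := mul_le_mul g1 g2 pm.le p1.le
    have h2 : r ^ m.1 ≤ M * s3 := le_of_mul_le_mul_left (by linarith) pm
    have : 0 ≤ M * s3 := by positivity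
    linarith

end HyperbolicCone

/-! ### The map from the cone to the trees -/

/-- All elements except the smallest lie in an interval of length `t` below `b`. -/
lemma Finset.card_le_of_gaps {S : Finset ℕ} {b t : ℕ} (hb : ∀ j ∈ S, j < b)
    (h : ∀ i ∈ S, ∀ j ∈ S, i < j → b ≤ j + t) : S.card ≤ t + 1 := by
  rcases S.eq_empty_or_nonempty with rfl | hne
  · simp
  have hsub : S.erase (S.min' hne) ⊆ Finset.Ico (b - t) b := fun j hj => by
    obtain ⟨h1, h2⟩ := Finset.mem_erase.mp hj
    have h3 := h _ (S.min'_mem hne) j h2 ((S.min'_le j h2).lt_of_ne (Ne.symm h1))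
    exact Finset.mem_Ico.mpr ⟨by omega, hb j h2⟩
  have h1 := Finset.card_le_card hsub
  rw [Finset.card_erase_of_mem (S.min'_mem hne), Nat.card_Ico] at h1
  omega

lemma Finset.gap_comm {α : Type*} [DecidableEq α] (P Q R : Finset α) :
    Finset.gap P Q R = Finset.gap Q P R := by
  rw [Finset.gap, Finset.gap, Finset.union_comm, Finset.inter_comm]

namespace ColouredCovers

variable {Z : Type*} [PseudoMetricSpace Z] {C : Type*} {r ε : ℝ} {𝒰 : ColouredCovers Z C r ε}

lemma card_le_of_gaps {c : C} {S : Finset (𝒰.TreeVertex c)} {z : Z} {b t : ℕ}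
    (hz : ∀ q ∈ S, z ∈ (q.2 : Set Z)) (hb : ∀ q ∈ S, q.1 < b)
    (h : ∀ p ∈ S, ∀ q ∈ S, p.1 < q.1 → b ≤ q.1 + t) : S.card ≤ t + 1 := by
  classical
  rw [← Finset.card_image_of_injOn (f := Sigma.fst) (s := S) fun p hp q hq hpq =>
    treeVertex_eq_of_level_eq hpq ⟨z, hz p hp, hz q hq⟩]
  refine Finset.card_le_of_gaps (b := b) ?_ ?_
  · intro j hj
    obtain ⟨q, hq, rfl⟩ := Finset.mem_image.mp hj
    exact hb q hq
  · intro i hi j hj hij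
    obtain ⟨p, hp, rfl⟩ := Finset.mem_image.mp hi
    obtain ⟨q, hq, rfl⟩ := Finset.mem_image.mp hj
    exact h p hp q hq hij

lemma mem_of_ball_subset {H : HyperbolicCone Z r} {v : H.Vertex} {U : Set Z} (h : v.ball ⊆ U) :
    (v.2 : Z) ∈ U :=
  h (Metric.mem_ball_self (mul_pos two_pos (pow_pos H.pos _)))

/-- If `q` is a member of level below that of `p`, and `z` lies in both, then all balls near `z`
whose size is small compared with `q` lie in `p`. -/
lemma ball_subset_of_level_lt (hε : 0 < ε) {H : HyperbolicCone Z r} {c : C}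
    {p q : 𝒰.TreeVertex c} (hlt : p.1 < q.1) {z : Z} (hp : z ∈ (p.2 : Set Z))
    (hq : z ∈ (q.2 : Set Z)) {v : H.Vertex}
    (hv : dist (v.2 : Z) z + 2 * r ^ v.1 ≤ ε * r ^ q.1) : v.ball ⊆ p.2 := by
  refine Subset.trans (fun x hx => ?_) (thickening_subset_of_ne hε H.pos hlt.le
    (fun h => by rw [h] at hlt; omega) ⟨z, hp, hq⟩)
  rw [HyperbolicCone.Vertex.ball, Metric.mem_ball] at hx
  have := dist_triangle x v.2 z
  exact Metric.mem_thickening_iff.mpr ⟨z, hq, by linarith⟩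

open Classical in
-- Let `p` have smaller level than `q`, both containing the ball of `m`. If `q` is much larger than
-- `r ^ m.1`, the ball of `v` lies in the `ε`-neighbourhood of `q`, hence in `p`. So apart from the
-- one of smallest level, all counted members have level within about `s` of `m.1`.
lemma card_ancestors_sdiff_le (hε : 0 < ε) {H : HyperbolicCone Z r} {M : ℝ} (hM : 1 ≤ M) {s : ℕ}
    (hs : 3 * M * r ^ s < 1) (hsε : 3 * M * r ^ s ≤ ε) {v m : H.Vertex}
    (hv : H.scale v m ≤ M * r ^ m.1) (c : C) :
    (𝒰.ancestors (𝒰.vertexMap c m) \ 𝒰.ancestors (𝒰.vertexMap c v)).card ≤ s + 1 := by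
  have hr := H.pos
  have hr1 : r ≤ 1 := by have := H.le; linarith
  have hdist : dist (v.2 : Z) m.2 + r ^ v.1 ≤ M * r ^ m.1 := by
    have := pow_pos hr m.1
    rw [HyperbolicCone.scale] at hv
    linarith
  have hd0 := dist_nonneg (x := (v.2 : Z)) (y := m.2)
  have hpm := pow_pos hr m.1
  have hpv := pow_pos hr v.1
  have hmem : ∀ q ∈ 𝒰.ancestors (𝒰.vertexMap c m) \ 𝒰.ancestors (𝒰.vertexMap c v),
      (q.1 ≤ m.1 - 1 ∧ m.ball ⊆ q.2) ∧ ¬ (q.1 ≤ v.1 - 1 ∧ v.ball ⊆ q.2) := fun q hq => by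
    rw [Finset.mem_sdiff] at hq
    exact ⟨(𝒰.mem_ancestors_vertexMap hε hr).mp hq.1,
      fun h => hq.2 ((𝒰.mem_ancestors_vertexMap hε hr).mpr h)⟩
  refine card_le_of_gaps (z := (m.2 : Z)) (b := m.1 + 1) (t := s)
    (fun q hq => mem_of_ball_subset (hmem q hq).1.2) ?_ ?_
  · intro q hq
    have := (hmem q hq).1.1
    omega
  · intro p hp q hq hpq
    by_contra! hcon
    have hqs : q.1 + s ≤ m.1 := by omega
    have h1 : r ^ m.1 ≤ r ^ s * r ^ q.1 := by
      rw [← pow_add]; exact pow_le_pow_of_le_one hr.le hr1 (by omega)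
    have hpq' := pow_pos hr q.1
    have h2 : 3 * M * r ^ m.1 ≤ 3 * M * r ^ s * r ^ q.1 := by
      rw [mul_assoc (3 * M)]; exact mul_le_mul_of_nonneg_left h1 (by linarith)
    have hqv : q.1 < v.1 := by
      by_contra! hle
      have h3 : r ^ q.1 ≤ r ^ v.1 := pow_le_pow_of_le_one hr.le hr1 hle
      have h4 : 3 * M * r ^ s * r ^ q.1 < r ^ q.1 := by
        have := mul_lt_mul_of_pos_right hs hpq'; linarith
      have h5 : 0 < M * r ^ m.1 := by positivity
      linarith
    refine (hmem p hp).2 ⟨by omega, ball_subset_of_level_lt hε hpq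
      (mem_of_ball_subset (hmem p hp).1.2) (mem_of_ball_subset (hmem q hq).1.2) ?_⟩
    have h6 := mul_le_mul_of_nonneg_right hsε hpq'.le
    linarith

open Classical in
-- A member containing the balls of both `v` and `w` has level below `m.1 + s`, by the mesh bound
-- and `r ^ m.1 ≤ M * scale v w`. Levels below `m.1 - s` are excluded, apart from the smallest, by
-- absorbing the ball of `m` through nestedness.
lemma card_inter_ancestors_sdiff_le (hε : 0 < ε) {H : HyperbolicCone Z r} {M : ℝ} (hM : 1 ≤ M)
    {s : ℕ} (hs : 3 * M * r ^ s < 1) (hsε : 3 * M * r ^ s ≤ ε) {v w m : H.Vertex}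
    (hv : H.scale v m ≤ M * r ^ m.1) (hvw : r ^ m.1 ≤ M * H.scale v w) (c : C) :
    ((𝒰.ancestors (𝒰.vertexMap c v) ∩ 𝒰.ancestors (𝒰.vertexMap c w)) \
      𝒰.ancestors (𝒰.vertexMap c m)).card ≤ 2 * s + 1 := by
  have hr := H.pos
  have hr1 : r ≤ 1 := by have := H.le; linarith
  have hdist : dist (m.2 : Z) v.2 + r ^ m.1 ≤ M * r ^ m.1 := by
    have := pow_pos hr v.1
    rw [HyperbolicCone.scale, dist_comm] at hv
    linarith
  have hpm := pow_pos hr m.1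
  have hmem : ∀ q ∈ (𝒰.ancestors (𝒰.vertexMap c v) ∩ 𝒰.ancestors (𝒰.vertexMap c w)) \
      𝒰.ancestors (𝒰.vertexMap c m), (q.1 ≤ v.1 - 1 ∧ v.ball ⊆ q.2) ∧
      (q.1 ≤ w.1 - 1 ∧ w.ball ⊆ q.2) ∧ ¬ (q.1 ≤ m.1 - 1 ∧ m.ball ⊆ q.2) := fun q hq => by
    rw [Finset.mem_sdiff, Finset.mem_inter] at hq
    exact ⟨(𝒰.mem_ancestors_vertexMap hε hr).mp hq.1.1,
      (𝒰.mem_ancestors_vertexMap hε hr).mp hq.1.2,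
      fun h => hq.2 ((𝒰.mem_ancestors_vertexMap hε hr).mpr h)⟩
  refine card_le_of_gaps (z := (v.2 : Z)) (b := m.1 + s) (t := 2 * s)
    (fun q hq => mem_of_ball_subset (hmem q hq).1.2) ?_ ?_
  · intro q hq
    obtain ⟨h1, h2, -⟩ := hmem q hq
    by_contra! hle
    have hpq := pow_pos hr q.1
    have h3 : H.scale v w ≤ 3 * r ^ q.1 := by
      obtain ⟨ρ, hρ, hmesh⟩ := 𝒰.mesh q.1
      have e1 := hmesh c q.2 q.2.2 v.2 (mem_of_ball_subset h1.2) w.2 (mem_of_ball_subset h2.2)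
      have e2 : r ^ v.1 ≤ r ^ q.1 := pow_le_pow_of_le_one hr.le hr1 (by omega)
      have e3 : r ^ w.1 ≤ r ^ q.1 := pow_le_pow_of_le_one hr.le hr1 (by omega)
      rw [HyperbolicCone.scale]
      linarith
    have h4 : r ^ q.1 ≤ r ^ s * r ^ m.1 := by
      rw [← pow_add]; exact pow_le_pow_of_le_one hr.le hr1 (by omega)
    have h5 : M * H.scale v w ≤ M * (3 * (r ^ s * r ^ m.1)) :=
      mul_le_mul_of_nonneg_left (by linarith) (by linarith)
    have h6 := mul_lt_mul_of_pos_right hs hpm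
    linarith
  · intro p hp q hq hpq
    by_contra! hcon
    have h1 : r ^ m.1 ≤ r ^ s * r ^ q.1 := by
      rw [← pow_add]; exact pow_le_pow_of_le_one hr.le hr1 (by omega)
    have hpq' := pow_pos hr q.1
    have h2 : 3 * M * r ^ m.1 ≤ 3 * M * r ^ s * r ^ q.1 := by
      rw [mul_assoc (3 * M)]; exact mul_le_mul_of_nonneg_left h1 (by linarith)
    refine (hmem p hp).2.2 ⟨by omega, ball_subset_of_level_lt hε hpq
      (mem_of_ball_subset (hmem p hp).1.2) (mem_of_ball_subset (hmem q hq).1.2) ?_⟩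
    have h6 := mul_le_mul_of_nonneg_right hsε hpq'.le
    have h7 : r ^ m.1 ≤ M * r ^ m.1 := by
      have := mul_le_mul_of_nonneg_right hM hpm.le; linarith
    linarith

open Classical in
/-- The image of a vertex close to a geodesic is close to the geodesic of the tree between the
images of its ends. -/
theorem exists_gap_le (hε : 0 < ε) {H : HyperbolicCone Z r} [BoundedSpace Z]
    (hZ : Metric.diam (univ : Set Z) < 1) (hc : H.graph.Connected) (K : ℕ) :
    ∃ B : ℕ, ∀ v w m : H.Vertex,
      H.graph.dist v m + H.graph.dist m w ≤ H.graph.dist v w + K → ∀ c,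
      Finset.gap (𝒰.ancestors (𝒰.vertexMap c v)) (𝒰.ancestors (𝒰.vertexMap c w))
        (𝒰.ancestors (𝒰.vertexMap c m)) ≤ B := by
  have hr := H.pos
  have hr1 : r < 1 := by have := H.le; linarith
  obtain ⟨M, hM, h⟩ := HyperbolicCone.exists_scale_le hZ hc K
  obtain ⟨s, hs⟩ := exists_pow_lt_of_lt_one
    (show (0 : ℝ) < min 1 ε / (3 * M) by have := lt_min one_pos hε; positivity) hr1
  rw [lt_div_iff₀ (by linarith), mul_comm, lt_min_iff] at hs
  have key : ∀ v w m : H.Vertex, H.scale v m ≤ M * r ^ m.1 → r ^ m.1 ≤ M * H.scale v w → ∀ c,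
      Finset.gap (𝒰.ancestors (𝒰.vertexMap c v)) (𝒰.ancestors (𝒰.vertexMap c w))
        (𝒰.ancestors (𝒰.vertexMap c m)) ≤ (s + 1) + (2 * s + 1) := by
    intro v w m h1 h2 c
    refine add_le_add (le_trans (Finset.card_le_card ?_)
      (card_ancestors_sdiff_le hε hM hs.1 hs.2.le h1 c))
      (card_inter_ancestors_sdiff_le hε hM hs.1 hs.2.le h1 h2 c)
    exact Finset.sdiff_subset_sdiff Finset.Subset.rfl Finset.subset_union_left
  refine ⟨(s + 1) + (2 * s + 1), fun v w m hvw c => ?_⟩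
  obtain ⟨h1 | h1, h2⟩ := h v w m hvw
  · exact key v w m h1 h2 c
  · rw [Finset.gap_comm]
    exact key w v m h1 (by rwa [HyperbolicCone.scale_comm]) c

end ColouredCovers

/-! ### Vertices in the realization of a graph -/

namespace Realization

variable {V : Type*} {G : SimpleGraph V} {hG : G.Connected}

lemma dist_mk_le {p q : PrePoint G hG} {l : ℝ} (h : PrePoint.Joins p q l) :
    dist (SeparationQuotient.mk p) (SeparationQuotient.mk q) ≤ l := by
  rw [SeparationQuotient.dist_mk]
  exact csInf_le ⟨0, fun _ h => PrePoint.Joins.nonneg h⟩ h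

lemma le_dist_mk {p q : PrePoint G hG} {a : ℝ} (h : ∀ l, PrePoint.Joins p q l → a ≤ l) :
    a ≤ dist (SeparationQuotient.mk p) (SeparationQuotient.mk q) := by
  rw [SeparationQuotient.dist_mk]
  exact le_csInf ⟨_, .through false false⟩ h

lemma dist_vertex (u v : V) : dist (vertex G hG u) (vertex G hG v) = G.dist u v := by
  refine le_antisymm ?_ (le_dist_mk ?_)
  · refine (dist_mk_le (.through false false)).trans_eq ?_
    change (0 : ℝ) + (G.dist u v : ℕ) + 0 = (G.dist u v : ℕ)
    ring
  · rintro l (⟨b, b'⟩ | ⟨h, -⟩ | ⟨h, -⟩)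
    · have h1 : ∀ (w : V) (b : Bool), 0 ≤ PrePoint.offset (hG := hG)
          ⟨w, w, 0, le_rfl, zero_le_one, Or.inr ⟨rfl, rfl⟩⟩ b := fun w b =>
        PrePoint.offset_nonneg _ b
      have h2 := h1 u b
      have h3 := h1 v b'
      have h4 : ∀ (w : V) (b : Bool), PrePoint.endpt (hG := hG)
          ⟨w, w, 0, le_rfl, zero_le_one, Or.inr ⟨rfl, rfl⟩⟩ b = w := fun w b => by
        cases b <;> rfl
      rw [h4, h4]
      linarith
    · have : u = v := h
      rw [this, SimpleGraph.dist_self, Nat.cast_zero]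
      exact abs_nonneg _
    · have : u = v := h
      rw [this, SimpleGraph.dist_self, Nat.cast_zero]
      exact abs_nonneg _

lemma isometry_vertex :
    Isometry (fun v : VertexSpace G hG => (vertex G hG v : Realization G hG)) :=
  Isometry.of_dist_eq fun u v => dist_vertex (hG := hG) u v

lemma dist_mk_src_le (p : PrePoint G hG) :
    dist (vertex G hG p.src) (SeparationQuotient.mk p) ≤ 1 := by
  rw [dist_comm]
  refine (dist_mk_le (.through false false)).trans ?_
  change p.t + (G.dist p.src p.src : ℕ) + 0 ≤ 1
  rw [SimpleGraph.dist_self]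
  have := p.t_le
  push_cast
  linarith

lemma dist_mk_tgt_le (p : PrePoint G hG) :
    dist (vertex G hG p.tgt) (SeparationQuotient.mk p) ≤ 1 := by
  rw [dist_comm]
  refine (dist_mk_le (.through true false)).trans ?_
  change 1 - p.t + (G.dist p.tgt p.tgt : ℕ) + 0 ≤ 1
  rw [SimpleGraph.dist_self]
  have := p.t_nonneg
  push_cast
  linarith

lemma exists_vertex_near (x : Realization G hG) : ∃ v : V, dist (vertex G hG v) x ≤ 1 := by
  obtain ⟨p, rfl⟩ := SeparationQuotient.surjective_mk x
  exact ⟨p.src, dist_mk_src_le p⟩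

end Realization

/-- Coarse medians on a connected hyperbolic graph are close to all geodesics between the three
points. -/
theorem IsCoarseMedian.exists_excess_le {V : Type*} {G : SimpleGraph V} {hG : G.Connected} {δ : ℝ}
    (hδ0 : 0 ≤ δ) (hδ : FourPoint (VertexSpace G hG) δ)
    {μ : Realization G hG → Realization G hG → Realization G hG → Realization G hG}
    (hμ : IsCoarseMedian μ) : ∃ K : ℝ, ∀ (x₁ x₂ x₃ : Realization G hG)
      (v₁ v₂ v₃ v : VertexSpace G hG), dist (Realization.vertex G hG v₁) x₁ ≤ 1 →
      dist (Realization.vertex G hG v₂) x₂ ≤ 1 → dist (Realization.vertex G hG v₃) x₃ ≤ 1 →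
      dist (Realization.vertex G hG v) (μ x₁ x₂ x₃) ≤ 1 →
      excess v₁ v₂ v ≤ K ∧ excess v₂ v₃ v ≤ K ∧ excess v₁ v₃ v ≤ K := by
  obtain ⟨π, hπ⟩ : ∃ π : Realization G hG → VertexSpace G hG,
      ∀ x, dist (Realization.vertex G hG (π x)) x ≤ 1 :=
    ⟨fun x => (Realization.exists_vertex_near x).choose,
      fun x => (Realization.exists_vertex_near x).choose_spec⟩
  let i : VertexSpace G hG → Realization G hG := fun v => Realization.vertex G hG v
  have hi : Isometry i := Realization.isometry_vertex
  have hgeo := hasIntegerGeodesics_vertexSpace G hG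
  obtain ⟨C, hC⟩ := hμ.exists_identities
  have bound : ∀ {ν : Realization G hG → Realization G hG → Realization G hG → Realization G hG},
      IsCoarseMedian ν → ∃ K : ℝ, ∀ a b c : VertexSpace G hG,
        excess a b (π (ν (i a) (i b) (i c)) : VertexSpace G hG) ≤ K := fun hν => by
    obtain ⟨C, hC⟩ := (hν.transport i hi π hπ).exists_identities
    exact hC.exists_excess_le hδ0 hδ hgeo
  -- The two rotations evaluate to the same point `μ (i v₁) (i v₂) (i v₃)` and control the two other
  -- pairs.
  obtain ⟨K₁, hK₁⟩ := bound hμ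
  obtain ⟨K₂, hK₂⟩ := bound hμ.rotate
  obtain ⟨K₃, hK₃⟩ := bound hμ.rotate.rotate
  refine ⟨max K₁ (max K₂ K₃) + 2 * (2 + C * 4), fun x₁ x₂ x₃ v₁ v₂ v₃ v h₁ h₂ h₃ h => ?_⟩
  have hnear : dist v (π (μ (i v₁) (i v₂) (i v₃)) : VertexSpace G hG) ≤ 2 + C * 4 := by
    rw [← hi.dist_eq]
    have e1 := dist_triangle4 (i v) (μ x₁ x₂ x₃) (μ (i v₁) (i v₂) (i v₃))
      (i (π (μ (i v₁) (i v₂) (i v₃))))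
    have e2 := hC.lipschitz x₁ (i v₁) x₂ (i v₂) x₃ (i v₃)
    have e3 := hπ (μ (i v₁) (i v₂) (i v₃))
    rw [dist_comm] at e3 h₁ h₂ h₃
    have e4 : C * (1 + dist x₁ (i v₁) + dist x₂ (i v₂) + dist x₃ (i v₃)) ≤ C * 4 :=
      mul_le_mul_of_nonneg_left (by linarith) hC.nonneg
    linarith
  have hex : ∀ a b m : VertexSpace G hG, excess a b v ≤ excess a b m + 2 * dist v m := by
    intro a b m
    have e1 := dist_triangle_right a v m
    have e2 := dist_triangle v m b
    simp only [excess]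
    linarith
  have m1 := le_max_left K₁ (max K₂ K₃)
  have m2 := (le_max_left K₂ K₃).trans (le_max_right K₁ _)
  have m3 := (le_max_right K₂ K₃).trans (le_max_right K₁ _)
  refine ⟨?_, ?_, ?_⟩
  · have e1 := hex v₁ v₂ (π (μ (i v₁) (i v₂) (i v₃)))
    have e2 := hK₁ v₁ v₂ v₃
    linarith
  · have e1 := hex v₂ v₃ (π (μ (i v₁) (i v₂) (i v₃)))
    have e2 := hK₃ v₂ v₃ v₁
    linarith
  · have e1 := hex v₃ v₁ (π (μ (i v₁) (i v₂) (i v₃)))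
    have e2 := hK₂ v₃ v₁ v₂
    rw [excess_comm]
    linarith

/-! ### The quasimedian property -/

namespace ColouredCovers

variable {Z : Type*} [PseudoMetricSpace Z] {C : Type*} {r ε : ℝ} {𝒰 : ColouredCovers Z C r ε}

/-- The vertex depends on the colour, because the end of an edge may be chosen differently for each
colour. For this reason the excess bound for coarse medians allows arbitrary vertices near the
points. -/
lemma IsBDSMap.exists_vertex {H : HyperbolicCone Z r} [BoundedSpace Z] [Nonempty Z]
    {hZ : Metric.diam (univ : Set Z) < 1} {F : H.Space hZ → ∀ c, 𝒰.TreeSpace c}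
    (hF : 𝒰.IsBDSMap hZ F) (x : H.Space hZ) (c : C) :
    ∃ v : H.Vertex, dist (Realization.vertex H.graph (H.graph_connected hZ) v) x ≤ 1 ∧
      F x c = 𝒰.vertexMap c v := by
  obtain ⟨p, rfl⟩ := SeparationQuotient.surjective_mk x
  rcases hp : p.adj with h | ⟨h1, h2⟩
  · rcases hF.2 p.src p.tgt h p.t ⟨p.t_nonneg, p.t_le⟩ c with h3 | h3
    · exact ⟨p.src, Realization.dist_mk_src_le p, h3⟩
    · exact ⟨p.tgt, Realization.dist_mk_tgt_le p, h3⟩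
  · refine ⟨p.src, Realization.dist_mk_src_le p, ?_⟩
    rw [← hF.1]
    obtain ⟨a, b, t, h3, h4, h5⟩ := p
    obtain rfl : a = b := h1
    obtain rfl : t = 0 := h2
    rfl

/-- The maps to the product of the trees are quasimedian. -/
theorem IsBDSMap.isQuasimedian [Fintype C] (hε : 0 < ε) {H : HyperbolicCone Z r} [BoundedSpace Z]
    [Nonempty Z] {hZ : Metric.diam (univ : Set Z) < 1} {F : H.Space hZ → ∀ c, 𝒰.TreeSpace c}
    (hF : 𝒰.IsBDSMap hZ F) {μ : H.Space hZ → H.Space hZ → H.Space hZ → H.Space hZ}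
    (hμ : IsCoarseMedian μ) : IsQuasimedian μ 𝒰.productMedian F := by
  classical
  have hc := H.graph_connected hZ
  obtain ⟨δ, hδ0, hδ⟩ := HyperbolicCone.exists_fourPoint hZ hc
  obtain ⟨K, hK⟩ := hμ.exists_excess_le hδ0 hδ
  obtain ⟨B, hB⟩ := 𝒰.exists_gap_le hε hZ hc ⌈K⌉₊
  have hgap : ∀ (v w m : H.Vertex), excess (X := VertexSpace H.graph hc) v w m ≤ K → ∀ c,
      Finset.gap (𝒰.ancestors (𝒰.vertexMap c v)) (𝒰.ancestors (𝒰.vertexMap c w))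
        (𝒰.ancestors (𝒰.vertexMap c m)) ≤ B := by
    intro v w m h
    refine hB v w m ?_
    have h1 : ((H.graph.dist v m : ℕ) : ℝ) + (H.graph.dist m w : ℕ) -
      (H.graph.dist v w : ℕ) ≤ K := h
    have h2 := Nat.le_ceil K
    have h3 : ((H.graph.dist v m : ℕ) : ℝ) + (H.graph.dist m w : ℕ) ≤
      (H.graph.dist v w : ℕ) + (⌈K⌉₊ : ℕ) := by linarith
    exact_mod_cast h3
  -- The product carries the supremum metric and `B` does not depend on the colour, so one colour at
  -- a time suffices.
  refine ⟨(B + B + B : ℕ), fun x₁ x₂ x₃ => (dist_pi_le_iff (Nat.cast_nonneg _)).mpr fun c => ?_⟩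
  obtain ⟨v₁, h₁, e₁⟩ := hF.exists_vertex x₁ c
  obtain ⟨v₂, h₂, e₂⟩ := hF.exists_vertex x₂ c
  obtain ⟨v₃, h₃, e₃⟩ := hF.exists_vertex x₃ c
  obtain ⟨v, h, e⟩ := hF.exists_vertex (μ x₁ x₂ x₃) c
  obtain ⟨g1, g2, g3⟩ := hK x₁ x₂ x₃ v₁ v₂ v₃ v h₁ h₂ h₃ h
  rw [productMedian, e, e₁, e₂, e₃]
  have := (𝒰.dist_graphMedian_le hε H.pos (𝒰.vertexMap c v₁) (𝒰.vertexMap c v₂)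
    (𝒰.vertexMap c v₃) (𝒰.vertexMap c v)).trans
    (add_le_add (add_le_add (hgap _ _ _ g1 c) (hgap _ _ _ g2 c)) (hgap _ _ _ g3 c))
  exact Nat.cast_le (α := ℝ).mpr this

end ColouredCovers

theorem mainTheorem5 {Z : Type*} [MetricSpace Z] [CompleteSpace Z] [BoundedSpace Z] [Nonempty Z]
    (hZ : Metric.diam (Set.univ : Set Z) < 1) (n : ℕ) (hn : capacityDim Z = (n : ℕ∞)) :
    (∃ ε : ℝ, 0 < ε ∧ ε < 1 ∧ ∃ r₀ : ℝ, 0 < r₀ ∧ ∀ r : ℝ, 0 < r → r < r₀ → r < ε / 4 →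
      ∃ 𝒰 : ColouredCovers Z (Fin (n + 1)) r ε,
        ∀ H : HyperbolicCone Z r, 𝒰.IsSubordinate H) ∧
    ∀ ε r : ℝ, 0 < ε → ε < 1 → 0 < r → r < ε / 4 → r < 1 / 7 →
      ∀ (H : HyperbolicCone Z r) (𝒰 : ColouredCovers Z (Fin (n + 1)) r ε), 𝒰.IsSubordinate H →
        (∀ c, (𝒰.tree c).IsTree) ∧
        ∀ F : H.Space hZ → ∀ c, 𝒰.TreeSpace c, 𝒰.IsBDSMap hZ F →
          ∀ μ : H.Space hZ → H.Space hZ → H.Space hZ → H.Space hZ, IsCoarseMedian μ →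
            IsQuasimedian μ 𝒰.productMedian F :=
  ⟨(CapacityDimLE.of_capacityDim_eq hn).exists_colouredCovers hZ,
    fun _ _ hε _ _ _ _ _ 𝒰 _ => ⟨𝒰.tree_isTree, fun _ hF _ hμ => hF.isQuasimedian hε hμ⟩⟩
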